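/- \textbf{Setting.} Let $n$ workers have computation powers $v_i:[0,\infty)\to[0,\infty)$, $i\in[n]$, that are continuous almost everywhere, and put $V_i(t)=\int_0^t v_i(\tau)\,d\tau$, so that $V_i(t)-V_i(s)=\int_s^t v_i(\tau)\,d\tau\in[0,\infty]$ for $s\le t$. An algorithm is a sequence of maps $A^k:(\mathbb R^d)^k\to\mathbb R_{\ge 0}\times[n]\times\{0,1\}\times\mathbb R^d$, $k\ge 0$. In the time multiple oracles protocol, all workers start in the state $s_i^0=(0,0,0)$, $t^0=0$, and for $k=0,1,2,\dots$ $$(t^{k+1},i^{k+1},c^{k+1},x^k)=A^k(g^1,\dots,g^k),\qquad (s^{k+1}_{i^{k+1}},g^{k+1})=O_{i^{k+1}}(t^{k+1},x^k,s^k_{i^{k+1}},c^{k+1}),$$ with $s_j^{k+1}=s_j^k$ for $j\neq i^{k+1}$, where $$O_i(t,x,(s_t,s_x,s_q),c)=\begin{cases}((t,x,1),\,0), & c=0,\ s_q=0,\\ ((s_t,s_x,1),\,0), & c=0,\ s_q=1,\ V_i(t)-V_i(s_t)<1,\\ ((0,0,0),\,g_i(s_x;\xi,t)), & c=0,\ s_q=1,\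 V_i(t)-V_i(s_t)\ge 1,\\ ((0,0,0),\,0), & c=1,\end{cases}$$ and $\xi$ is a fresh sample, independent of the past, from a distribution $\mathcal D$. The algorithm is zero-respecting if, for all $k\geq 0$ and all $g^1,\dots,g^k\in\mathbb R^d$, $\operatorname{supp}(x^k)\subseteq\bigcup_{j=1}^k\operatorname{supp}(g^j)$, and, for all $k\ge 1$, $t^{k+1}\ge t^k$, where $x^k, t^{k+1}$ are components of $A^k(g^1,\dots,g^k)$ and $t^k$ is that of $A^{k-1}(g^1,\dots,g^{k-1})$. \textbf{Theorem.} There are universal constants $c',c_1,c_2>0$ such that the following holds. Let $L,\Delta,\varepsilon>0$ satisfy $\varepsilon<c'L\Delta$, and let the dimension $d$ be at least a number $d_0$ that depends only on $L,\Delta,\varepsilon$. Let $\sigma^2\ge 0$, and let the computation powers $v_1,\dots,v_n$ be as above. Define $\underline t_0=0$ and $$\underline t_k=\min\Big\{t\ge 0:\ \sum_{i=1}^n\big\lfloor V_i(t)-V_i(\underline t_{k-1})\big\rfloor\ \ge\ c_2\max\big\{\lceil\sigma^2/\varepsilon\rceil,1\big\}\Big\},\qquad k\ge 1,$$ with $\min\emptyset=\infty$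 (and with $\inf$ in place of $\min$ should the minimum not be attained, which can happen only if some $V_i$ is infinite at a finite time). Then for every zero-respecting algorithm $A$ in $\mathbb R^d$ there are (i) a differentiable function $f:\mathbb R^d\to\mathbb R$ with $\|\nabla f(x)-\nabla f(y)\|\le L\|x-y\|$ for all $x,y$, and $f^*\in\mathbb R$ with $f(x)\ge f^*$ for all $x$ and $f(0)-f^*\le\Delta$; (ii) a distribution $\mathcal D$ and a stochastic gradient mapping $\nabla f(x;\xi)$, the same for all workers, i.e. $g_i(x;\xi,t)=\nabla f(x;\xi)$, with $\mathbb E_{\xi\sim\mathcal D}[\nabla f(x;\xi)]=\nabla f(x)$ and $\mathbb E_{\xi\sim\mathcal D}\big[\|\nabla f(x;\xi)-\nabla f(x)\|^2\big]\le\sigma^2$ for all $x\in\mathbb R^d$; such that the sequences $x^k,t^k$ generated by the protocol satisfy $$\mathbb E\Big[\inf_{k\in S_t}\|\nabla f(x^k)\|^2\Big]>\varepsilon,\qquad S_t=\{k\in\{0,1,2,\dots\}: t^k\le t\},\qquad t=\tfrac12\,\underline t_{\lfloor c_1 L\Delta/\varepsilon\rfloor}.$$ -/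

import Mathlib

open MeasureTheory
open scoped ENNReal NNReal

noncomputable section

namespace TimeOracle

/-- The point space `ℝ^d` with its Euclidean norm. -/
abbrev Pt (d : ℕ) : Type := EuclideanSpace ℝ (Fin d)

/-! ### Universal computation model -/

/-- A computation power `v : [0, ∞) → [0, ∞)` that is continuous almost everywhere.
(Values of `v` at negative arguments play no role.) -/
structure IsComputationPower (v : ℝ → ℝ) : Prop where
  nonneg : ∀ τ, 0 ≤ τ → 0 ≤ v τ
  ae_continuous : ∀ᵐ τ ∂(volume.restrict (Set.Ici (0 : ℝ))), ContinuousWithinAt v (Set.Ici 0) τ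

/-- The computation work `∫_s^t v(τ) dτ = V(t) - V(s)` from time `s` to time `t`, for times
`s, t ∈ [0, ∞]`. It is `0` when `t ≤ s`. -/
def work (v : ℝ → ℝ) (s t : ℝ≥0∞) : ℝ≥0∞ :=
  ∫⁻ τ in {τ : ℝ | s < ENNReal.ofReal τ ∧ ENNReal.ofReal τ ≤ t}, ENNReal.ofReal (v τ)

/-- The times `t_0 = 0`, `t_{k+1} = min {t ≥ 0 : ∑ i, ⌊V_i(t) - V_i(t_k)⌋ ≥ M}`, in `[0, ∞]`,
with the convention `min ∅ = ∞`. -/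
def lowerTime {n : ℕ} (v : Fin n → ℝ → ℝ) (M : ℝ) : ℕ → ℝ≥0∞
  | 0 => 0
  | k + 1 => sInf {t : ℝ≥0∞ | ENNReal.ofReal M ≤
      ((∑ i, ENat.floor (work (v i) (lowerTime v M k) t) : ℕ∞) : ℝ≥0∞)}

/-! ### Algorithms -/

/-- What an algorithm returns in iteration `k`: the time `t^{k+1}`, the index `i^{k+1}` of the
worker it calls, the control variable `c^{k+1}` (`true` stops the computation of the worker),
and the point `x^k`. -/
structure Query (n d : ℕ) where
  time : ℝ≥0
  worker : Fin n
  cancel : Bool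
  point : Pt d

/-- An algorithm `A = {A^k}`; `A k ![g^1, …, g^k]` is the query of iteration `k`. -/
abbrev Algorithm (n d : ℕ) : Type := (k : ℕ) → (Fin k → Pt d) → Query n d

/-- Zero-respecting algorithms: the support of `x^k` lies in the union of the supports of
`g^1, …, g^k`, and the times are non-decreasing. -/
structure Algorithm.IsZeroRespecting {n d : ℕ} (A : Algorithm n d) : Prop where
  supp_subset : ∀ (k : ℕ) (g : Fin k → Pt d) (a : Fin d),
    (A k g).point a ≠ 0 → ∃ j : Fin k, g j a ≠ 0
  time_mono : ∀ (k : ℕ) (g : Fin (k + 1) → Pt d),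
    (A k (Fin.init g)).time ≤ (A (k + 1) g).time

/-! ### Oracles and the time multiple oracles protocol -/

/-- The state `(s_t, s_x, s_q)` of an oracle. -/
structure OracleState (d : ℕ) where
  time : ℝ≥0
  point : Pt d
  busy : Bool

/-- The idle state `(0, 0, 0)`. -/
def OracleState.idle (d : ℕ) : OracleState d := ⟨0, 0, false⟩

open Classical in
/-- The oracle of a worker with computation power `v` and stochastic gradient mapping
`g x ξ t`, called at time `t` in the point `x` with state `s` and control variable `c`, where `ξ`
is the fresh sample. It returns the new state and the output vector. -/
def oracle {d : ℕ} {Ξ : Type} (v : ℝ → ℝ) (g : Pt d → Ξ → ℝ≥0 → Pt d) (ξ : Ξ)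
    (t : ℝ≥0) (x : Pt d) (s : OracleState d) (c : Bool) : OracleState d × Pt d :=
  if c = true then (OracleState.idle d, 0)
  else if s.busy = false then (⟨t, x, true⟩, 0)
  else if work v s.time t < 1 then (s, 0)
  else (OracleState.idle d, g s.point ξ t)

/-- The states of all workers and the vectors `g^1, …, g^k` after `k` iterations of the protocol.
`ω k` is the random sample available in iteration `k`. -/
def run {n d : ℕ} {Ξ : Type} (v : Fin n → ℝ → ℝ) (g : Fin n → Pt d → Ξ → ℝ≥0 → Pt d)
    (A : Algorithm n d) (ω : ℕ → Ξ) : (k : ℕ) → (Fin n → OracleState d) × (Fin k → Pt d)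
  | 0 => (fun _ => OracleState.idle d, Fin.elim0)
  | k + 1 =>
    let r := run v g A ω k
    let q := A k r.2
    let o := oracle (v q.worker) (g q.worker) (ω k) q.time q.point (r.1 q.worker) q.cancel
    (Function.update r.1 q.worker o.1, Fin.snoc r.2 o.2)

/-- The point `x^k` of the protocol. -/
def iterPoint {n d : ℕ} {Ξ : Type} (v : Fin n → ℝ → ℝ) (g : Fin n → Pt d → Ξ → ℝ≥0 → Pt d)
    (A : Algorithm n d) (ω : ℕ → Ξ) (k : ℕ) : Pt d :=
  (A k (run v g A ω k).2).point

/-- The time `t^k` of the protocol; the time starts from `t^0 = 0`. -/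
def iterTime {n d : ℕ} {Ξ : Type} (v : Fin n → ℝ → ℝ) (g : Fin n → Pt d → Ξ → ℝ≥0 → Pt d)
    (A : Algorithm n d) (ω : ℕ → Ξ) : ℕ → ℝ≥0
  | 0 => 0
  | k + 1 => (A k (run v g A ω k).2).time

/-- `inf_{k ∈ S_t} ‖∇f(x^k)‖²` with `S_t = {k : t^k ≤ t}`, as a function of the samples. -/
def bestGradSq {n d : ℕ} {Ξ : Type} (v : Fin n → ℝ → ℝ) (g : Fin n → Pt d → Ξ → ℝ≥0 → Pt d)
    (A : Algorithm n d) (f : Pt d → ℝ) (t : ℝ≥0∞) (ω : ℕ → Ξ) : ℝ≥0∞ :=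
  ⨅ k ∈ {k : ℕ | (iterTime v g A ω k : ℝ≥0∞) ≤ t},
    ENNReal.ofReal (‖gradient f (iterPoint v g A ω k)‖ ^ 2)

/-! ### Functions and stochastic gradients -/

/-- `f` is differentiable and its gradient is `L`-Lipschitz. -/
def IsSmooth {d : ℕ} (L : ℝ) (f : Pt d → ℝ) : Prop :=
  Differentiable ℝ f ∧ ∀ x y, ‖gradient f x - gradient f y‖ ≤ L * ‖x - y‖

/-- The stochastic gradient mapping `G x ξ`, `ξ ∼ D`, is an unbiased estimator of `∇f(x)` with
variance at most `σ²`, for every `x`. -/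
structure IsStochasticGradient {d : ℕ} {Ξ : Type} [MeasurableSpace Ξ] (D : Measure Ξ)
    (f : Pt d → ℝ) (σ : ℝ) (G : Pt d → Ξ → Pt d) : Prop where
  integrable : ∀ x, Integrable (G x) D
  unbiased : ∀ x, ∫ ξ, G x ξ ∂D = gradient f x
  integrable_sq : ∀ x, Integrable (fun ξ => ‖G x ξ - gradient f x‖ ^ 2) D
  variance_le : ∀ x, ∫ ξ, ‖G x ξ - gradient f x‖ ^ 2 ∂D ≤ σ ^ 2

end TimeOracle

end

/-!
# A chain that must be discovered one coordinate at a time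

The hard function is a smooth chain of `T` coordinates: a point supported on the first `ℓ`
coordinates has a gradient supported on the first `ℓ + 1`, and the gradient stays large until the
last coordinate is non-zero. The stochastic gradient shows the coordinate `ℓ` only when a coin of
success probability `p ≈ ε / σ²` comes up heads. Hence a zero-respecting algorithm climbs from the
level `ℓ` to `ℓ + 1` only through a successful coin toss, and the computation behind that toss was
begun after level `ℓ` was reached.

Call a level short if it is left within its first `M ≈ 1 / (4p)` tosses. At most `T M` tosses can
end a short level, each does with probability `p`, so on average at most `T / 4` levels are short,
and by Markov's inequality at least half of the levels are long with probability `1 / 2`. A long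
level contains at least `M` complete computations, hence lasts for at least one step of
`lowerTime`.
-/

noncomputable section

namespace TimeOracle

/-! ### Scalar building blocks -/

theorem hasDerivAt_max_zero_sq (x : ℝ) :
    HasDerivAt (fun y : ℝ => max y 0 ^ 2) (2 * max x 0) x := by
  have hO : (fun y : ℝ => max y 0 ^ 2 - max x 0 ^ 2 - (y - x) * (2 * max x 0)) =O[nhds x]
      fun y => ‖y - x‖ ^ 2 := by
    refine Asymptotics.IsBigO.of_bound 1 (Filter.Eventually.of_forall fun y => ?_)
    rw [one_mul, norm_pow, norm_norm, Real.norm_eq_abs, Real.norm_eq_abs, sq_abs, abs_le]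
    rcases max_cases y 0 with ⟨hy, _⟩ | ⟨hy, _⟩ <;> rcases max_cases x 0 with ⟨hx, _⟩ | ⟨hx, _⟩ <;>
      rw [hy, hx] <;> constructor <;> nlinarith
  rw [hasDerivAt_iff_isLittleO]
  exact hO.trans_isLittleO (Asymptotics.isLittleO_norm_pow_id one_lt_two |>.comp_tendsto
    (tendsto_sub_nhds_zero_iff.2 Filter.tendsto_id))

/-- The activation `x₊² / (1 + x₊²)` of a link of the chain; it vanishes on `(-∞, 0]`. -/
def activation (x : ℝ) : ℝ := 1 - (1 + max x 0 ^ 2)⁻¹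

/-- The derivative of `activation`. -/
def activation' (x : ℝ) : ℝ := 2 * max x 0 / (1 + max x 0 ^ 2) ^ 2

/-- A bounded, positive, increasing function: the reward for moving a coordinate upwards. -/
def ramp (x : ℝ) : ℝ := Real.arctan x + Real.pi / 2

/-- The derivative of `ramp`. -/
def ramp' (x : ℝ) : ℝ := (1 + x ^ 2)⁻¹

/-- A penalty for negative coordinates, which excludes stationary points at `-∞`, where `ramp'`
tends to zero. -/
def penalty (x : ℝ) : ℝ := max (-x) 0 ^ 2 / 2

/-- The derivative of `penalty`. -/
def penalty' (x : ℝ) : ℝ := -max (-x) 0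

theorem hasDerivAt_activation (x : ℝ) : HasDerivAt activation (activation' x) x :=
  (((hasDerivAt_max_zero_sq x).const_add 1).inv (by positivity)).const_sub 1 |>.congr_deriv
    (by simp [activation', neg_div])

theorem hasDerivAt_ramp (x : ℝ) : HasDerivAt ramp (ramp' x) x :=
  ((Real.hasDerivAt_arctan x).add_const (Real.pi / 2)).congr_deriv (by simp [ramp'])

theorem hasDerivAt_penalty (x : ℝ) : HasDerivAt penalty (penalty' x) x :=
  ((hasDerivAt_max_zero_sq (-x)).comp x (hasDerivAt_neg x)).div_const 2 |>.congr_deriv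
    (by rw [penalty']; ring)

theorem activation_nonneg (x : ℝ) : 0 ≤ activation x := by
  have : (1 + max x 0 ^ 2)⁻¹ ≤ 1 := inv_le_one_of_one_le₀ (by nlinarith [sq_nonneg (max x 0)])
  unfold activation; linarith

theorem activation_le_one (x : ℝ) : activation x ≤ 1 := by
  have : 0 ≤ (1 + max x 0 ^ 2)⁻¹ := by positivity
  unfold activation; linarith

theorem half_le_activation {x : ℝ} (hx : 1 ≤ x) : 1 / 2 ≤ activation x := by
  have h : (1 + max x 0 ^ 2)⁻¹ ≤ 2⁻¹ := by
    apply inv_anti₀ (by norm_num)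
    rw [max_eq_left (by linarith)]; nlinarith
  unfold activation; linarith

@[simp] theorem activation_zero : activation 0 = 0 := by simp [activation]

@[simp] theorem activation'_zero : activation' 0 = 0 := by simp [activation']

@[simp] theorem penalty_zero : penalty 0 = 0 := by simp [penalty]

@[simp] theorem penalty'_zero : penalty' 0 = 0 := by simp [penalty']

theorem activation'_nonneg (x : ℝ) : 0 ≤ activation' x := by unfold activation'; positivity

theorem activation'_le_one (x : ℝ) : activation' x ≤ 1 := by
  unfold activation'
  rw [div_le_one (by positivity)]
  nlinarith [sq_nonneg (max x 0 - 1), sq_nonneg (max x 0), sq_nonneg (max x 0 ^ 2)]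

theorem ramp_nonneg (x : ℝ) : 0 ≤ ramp x := by
  have := Real.neg_pi_div_two_lt_arctan x
  unfold ramp; linarith

theorem ramp_le_four (x : ℝ) : ramp x ≤ 4 := by
  have := Real.arctan_lt_pi_div_two x
  have := Real.pi_le_four
  unfold ramp; linarith

theorem ramp'_nonneg (x : ℝ) : 0 ≤ ramp' x := by unfold ramp'; positivity

theorem ramp'_le_one (x : ℝ) : ramp' x ≤ 1 :=
  inv_le_one_of_one_le₀ (by nlinarith [sq_nonneg x])

theorem penalty_nonneg (x : ℝ) : 0 ≤ penalty x := by unfold penalty; positivity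

theorem penalty'_nonpos (x : ℝ) : penalty' x ≤ 0 :=
  neg_nonpos.2 (le_max_right _ _)

theorem abs_sub_le_of_hasDerivAt {f f' : ℝ → ℝ} {C : ℝ} (hf : ∀ x, HasDerivAt f (f' x) x)
    (hC : ∀ x, |f' x| ≤ C) (x y : ℝ) : |f x - f y| ≤ C * |x - y| :=
  convex_univ.norm_image_sub_le_of_norm_hasDerivWithin_le
    (fun z _ => (hf z).hasDerivWithinAt) (fun z _ => hC z) (Set.mem_univ y) (Set.mem_univ x)

theorem abs_activation_sub_le (x y : ℝ) : |activation x - activation y| ≤ |x - y| := by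
  simpa using abs_sub_le_of_hasDerivAt (C := 1) hasDerivAt_activation
    (fun x => (abs_of_nonneg (activation'_nonneg x)).trans_le (activation'_le_one x)) x y

theorem abs_ramp_sub_le (x y : ℝ) : |ramp x - ramp y| ≤ |x - y| := by
  simpa using abs_sub_le_of_hasDerivAt (C := 1) hasDerivAt_ramp
    (fun x => (abs_of_nonneg (ramp'_nonneg x)).trans_le (ramp'_le_one x)) x y

theorem abs_ramp'_sub_le (x y : ℝ) : |ramp' x - ramp' y| ≤ |x - y| := by
  have hderiv (x : ℝ) : HasDerivAt ramp' (-(2 * x) / (1 + x ^ 2) ^ 2) x :=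
    (((hasDerivAt_id x).pow 2).const_add 1).inv
      (by simp only [Pi.pow_apply, id_eq, ne_eq]; positivity) |>.congr_deriv (by simp)
  have hbound (x : ℝ) : |-(2 * x) / (1 + x ^ 2) ^ 2| ≤ 1 := by
    rw [abs_div, abs_of_pos (show 0 < (1 + x ^ 2) ^ 2 by positivity), div_le_one (by positivity),
      abs_le]
    constructor <;> nlinarith [sq_nonneg (x - 1), sq_nonneg (x + 1), sq_nonneg (x ^ 2)]
  simpa using abs_sub_le_of_hasDerivAt hderiv hbound x y

theorem abs_activation'_sub_le (x y : ℝ) : |activation' x - activation' y| ≤ 2 * |x - y| := by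
  have hderiv (u : ℝ) : HasDerivAt (fun u : ℝ => 2 * u / (1 + u ^ 2) ^ 2)
      ((2 - 6 * u ^ 2) / (1 + u ^ 2) ^ 3) u := by
    refine ((hasDerivAt_id u).const_mul 2).div ((((hasDerivAt_id u).pow 2).const_add 1).pow 2)
      (by simp only [Pi.pow_apply, id_eq, ne_eq, OfNat.ofNat_ne_zero, not_false_eq_true,
        pow_eq_zero_iff]; positivity) |>.congr_deriv ?_
    have : 1 + u ^ 2 ≠ 0 := by positivity
    simp only [id_eq, Pi.pow_apply, Nat.cast_ofNat, Nat.add_one_sub_one, pow_one, mul_one]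
    field_simp
    ring
  have hbound (u : ℝ) : |(2 - 6 * u ^ 2) / (1 + u ^ 2) ^ 3| ≤ 2 := by
    have := sq_nonneg u
    rw [abs_div, abs_of_pos (show 0 < (1 + u ^ 2) ^ 3 by positivity), div_le_iff₀ (by positivity),
      abs_le]
    constructor <;> nlinarith [pow_nonneg this 2, pow_nonneg this 3]
  calc |activation' x - activation' y| ≤ 2 * |max x 0 - max y 0| :=
        abs_sub_le_of_hasDerivAt hderiv hbound (max x 0) (max y 0)
    _ ≤ 2 * |x - y| := mul_le_mul_of_nonneg_left (abs_max_sub_max_le_abs x y 0) zero_le_two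

theorem abs_penalty'_sub_le (x y : ℝ) : |penalty' x - penalty' y| ≤ |x - y| := by
  have := abs_max_sub_max_le_abs (-x) (-y) 0
  rw [neg_sub_neg, abs_sub_comm y x] at this
  rwa [penalty', penalty', neg_sub_neg, abs_sub_comm]

theorem quarter_le_activation_mul_ramp'_sub_penalty' {a b : ℝ} (ha : 1 ≤ a) (hb : b < 1) :
    1 / 4 ≤ activation a * ramp' b - penalty' b := by
  have hact := half_le_activation ha
  have hramp := ramp'_nonneg b
  by_cases hb' : -1 ≤ b
  · have : 1 / 2 ≤ ramp' b := by
      unfold ramp'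
      rw [one_div]
      exact inv_anti₀ (by positivity) (by nlinarith)
    have := penalty'_nonpos b
    nlinarith
  · have : 1 ≤ max (-b) 0 := le_max_of_le_left (by linarith)
    unfold penalty'
    nlinarith

/-! ### Supports and zero chains -/

variable {d : ℕ}

/-- The coordinates of `x` with numbers `ℓ, ℓ + 1, …` vanish. -/
def SuppLT (ℓ : ℕ) (x : Pt d) : Prop := ∀ i : Fin d, ℓ ≤ i → x i = 0

theorem SuppLT.mono {ℓ ℓ' : ℕ} {x : Pt d} (hx : SuppLT ℓ x) (h : ℓ ≤ ℓ') : SuppLT ℓ' x :=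
  fun i hi => hx i (h.trans hi)

theorem SuppLT.smul {ℓ : ℕ} {x : Pt d} (hx : SuppLT ℓ x) (c : ℝ) : SuppLT ℓ (c • x) :=
  fun i hi => by simp [hx i hi]

theorem suppLT_zero (ℓ : ℕ) : SuppLT ℓ (0 : Pt d) := fun _ _ => rfl

/-- The vector field `g` reveals at most one new coordinate at a time. -/
def IsZeroChain (g : Pt d → Pt d) : Prop :=
  ∀ ⦃ℓ : ℕ⦄ ⦃x : Pt d⦄, SuppLT ℓ x → SuppLT (ℓ + 1) (g x)

/-! ### The chain function -/

/-- The coordinate functional number `j - 1` for `1 ≤ j ≤ T`, and `0` for all other `j`. -/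
def chainCoord (d T : ℕ) : ℕ → Pt d →L[ℝ] ℝ
  | 0 => 0
  | j + 1 => if h : j < d ∧ j < T then EuclideanSpace.proj ⟨j, h.1⟩ else 0

/-- The sequence `1, x_0, …, x_{T-1}, 0, 0, …` of the values of the links of the chain; the shift
by one makes room for the constant `1` that activates the first coordinate. -/
def chainSeq (T : ℕ) (x : Pt d) (j : ℕ) : ℝ := (if j = 0 then 1 else 0) + chainCoord d T j x

@[simp] theorem chainSeq_zero (T : ℕ) (x : Pt d) : chainSeq T x 0 = 1 := by
  simp [chainSeq, chainCoord]

theorem chainCoord_succ {T : ℕ} (i : Fin d) (hi : (i : ℕ) < T) (x : Pt d) :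
    chainCoord d T (i + 1) x = x i := by
  simp [chainCoord, hi]

theorem chainCoord_succ_eq_zero {T j : ℕ} (hj : T ≤ j) : chainCoord d T (j + 1) = 0 :=
  dif_neg (by omega)

theorem chainSeq_succ_eq_zero {T ℓ j : ℕ} {x : Pt d} (hx : SuppLT ℓ x) (hj : ℓ ≤ j) :
    chainSeq T x (j + 1) = 0 := by
  by_cases h : j < d ∧ j < T
  · simpa [chainSeq, chainCoord, h] using hx ⟨j, h.1⟩ hj
  · simp [chainSeq, chainCoord, h]

theorem chainSeq_sub (T : ℕ) (x y : Pt d) (j : ℕ) :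
    chainSeq T x j - chainSeq T y j = chainCoord d T j (x - y) := by
  simp [chainSeq]

theorem sum_range_chainSeq_sub_sq_le (T : ℕ) (x y : Pt d) :
    ∑ j ∈ Finset.range d, (chainSeq T x (j + 1) - chainSeq T y (j + 1)) ^ 2 ≤ ‖x - y‖ ^ 2 := by
  rw [EuclideanSpace.norm_sq_eq, ← Fin.sum_univ_eq_sum_range
    (fun j => (chainSeq T x (j + 1) - chainSeq T y (j + 1)) ^ 2)]
  refine Finset.sum_le_sum fun i _ => ?_
  rw [chainSeq_sub]
  rcases lt_or_ge (i : ℕ) T with hi | hi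
  · rw [chainCoord_succ i hi, Real.norm_eq_abs, sq_abs]
  · rw [chainCoord_succ_eq_zero hi]
    simp only [zero_apply, zero_pow two_ne_zero]
    positivity

/-- The unscaled hard function, a chain of `T` coordinates: the reward for moving a coordinate is
switched on by the preceding one. -/
def chain (T : ℕ) (x : Pt d) : ℝ :=
  ∑ j ∈ Finset.range (T + 1),
    (penalty (chainSeq T x (j + 1)) - activation (chainSeq T x j) * ramp (chainSeq T x (j + 1)))

/-- The partial derivative of `chain` in the coordinate number `i < T`. -/
def chainPartial (T : ℕ) (x : Pt d) (i : ℕ) : ℝ :=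
  penalty' (chainSeq T x (i + 1)) - activation (chainSeq T x i) * ramp' (chainSeq T x (i + 1)) -
    activation' (chainSeq T x (i + 1)) * ramp (chainSeq T x (i + 2))

/-- The gradient of `chain`. -/
def chainGrad (T : ℕ) (x : Pt d) : Pt d :=
  WithLp.toLp 2 fun i => if (i : ℕ) < T then chainPartial T x i else 0

theorem chainGrad_apply (T : ℕ) (x : Pt d) (i : Fin d) :
    chainGrad T x i = if (i : ℕ) < T then chainPartial T x i else 0 := rfl

theorem inner_chainGrad {T : ℕ} (hT : T ≤ d) (x y : Pt d) :
    inner ℝ (chainGrad T x) y =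
      ∑ j ∈ Finset.range T, chainPartial T x j * chainCoord d T (j + 1) y := by
  have hterm (i : Fin d) : inner ℝ (chainGrad T x i) (y i) =
      chainPartial T x i * chainCoord d T (i + 1) y := by
    rw [chainGrad_apply]
    rcases lt_or_ge (i : ℕ) T with hi | hi
    · simp [hi, chainCoord_succ i hi, mul_comm]
    · simp [hi.not_gt, chainCoord_succ_eq_zero (d := d) hi]
  rw [PiLp.inner_apply, Finset.sum_congr rfl fun i _ => hterm i, Fin.sum_univ_eq_sum_range
    (fun j : ℕ => chainPartial T x j * chainCoord d T (j + 1) y)]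
  refine (Finset.sum_subset (Finset.range_subset_range.2 hT) fun j _ hj => ?_).symm
  simp [chainCoord_succ_eq_zero (d := d) (not_lt.1 (Finset.mem_range.not.1 hj))]

theorem hasFDerivAt_chainSeq (T : ℕ) (x : Pt d) (j : ℕ) :
    HasFDerivAt (fun x => chainSeq T x j) (chainCoord d T j) x :=
  (chainCoord d T j).hasFDerivAt.const_add _

theorem hasFDerivAt_chain (T : ℕ) (x : Pt d) :
    HasFDerivAt (chain T) (∑ j ∈ Finset.range (T + 1),
      (penalty' (chainSeq T x (j + 1)) • chainCoord d T (j + 1) -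
        (activation (chainSeq T x j) • ramp' (chainSeq T x (j + 1)) • chainCoord d T (j + 1) +
        ramp (chainSeq T x (j + 1)) • activation' (chainSeq T x j) • chainCoord d T j))) x :=
  HasFDerivAt.fun_sum fun j _ =>
    ((hasDerivAt_penalty _).comp_hasFDerivAt x (hasFDerivAt_chainSeq T x (j + 1))).sub
      (((hasDerivAt_activation _).comp_hasFDerivAt x (hasFDerivAt_chainSeq T x j)).mul
      ((hasDerivAt_ramp _).comp_hasFDerivAt x (hasFDerivAt_chainSeq T x (j + 1))))

theorem hasGradientAt_chain {T : ℕ} (hT : T ≤ d) (x : Pt d) :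
    HasGradientAt (chain T) (chainGrad T x) x := by
  rw [hasGradientAt_iff_hasFDerivAt]
  refine (hasFDerivAt_chain T x).congr_fderiv (ContinuousLinearMap.ext fun y => ?_)
  rw [InnerProductSpace.toDual_apply_apply, inner_chainGrad hT]
  simp only [sum_apply, sub_apply, smul_apply, smul_eq_mul, ← sub_sub]
  rw [Finset.sum_sub_distrib, Finset.sum_range_succ, Finset.sum_range_succ',
    chainCoord_succ_eq_zero (d := d) le_rfl]
  simp only [chainCoord, zero_apply, mul_zero, sub_zero, add_zero]
  rw [← Finset.sum_sub_distrib]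
  refine Finset.sum_congr rfl fun j _ => ?_
  rw [chainPartial]
  ring

theorem abs_mul_sub_mul_le {a b a' b' A B u w : ℝ} (ha : |a| ≤ A) (hb : |b'| ≤ B)
    (hu : |a - a'| ≤ u) (hw : |b - b'| ≤ w) : |a * b - a' * b'| ≤ A * w + B * u :=
  calc |a * b - a' * b'| = |a * (b - b') + b' * (a - a')| := by congr 1; ring
    _ ≤ |a| * |b - b'| + |b'| * |a - a'| := by
      simpa only [abs_mul] using abs_add_le (a * (b - b')) (b' * (a - a'))
    _ ≤ A * w + B * u := add_le_add
      (mul_le_mul ha hw (abs_nonneg _) ((abs_nonneg _).trans ha))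
      (mul_le_mul hb hu (abs_nonneg _) ((abs_nonneg _).trans hb))

theorem abs_chainPartial_sub_le (T : ℕ) (x y : Pt d) (i : ℕ) :
    |chainPartial T x i - chainPartial T y i| ≤
      |chainSeq T x i - chainSeq T y i| + 10 * |chainSeq T x (i + 1) - chainSeq T y (i + 1)| +
        |chainSeq T x (i + 2) - chainSeq T y (i + 2)| := by
  unfold chainPartial
  generalize chainSeq T x i = a, chainSeq T y i = a', chainSeq T x (i + 1) = b,
    chainSeq T y (i + 1) = b', chainSeq T x (i + 2) = c, chainSeq T y (i + 2) = c'
  have hpen := abs_penalty'_sub_le b b'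
  have hreward := abs_mul_sub_mul_le
    ((abs_of_nonneg (activation_nonneg a)).trans_le (activation_le_one a))
    ((abs_of_nonneg (ramp'_nonneg b')).trans_le (ramp'_le_one b'))
    (abs_activation_sub_le a a') (abs_ramp'_sub_le b b')
  have hnext := abs_mul_sub_mul_le
    ((abs_of_nonneg (activation'_nonneg b)).trans_le (activation'_le_one b))
    ((abs_of_nonneg (ramp_nonneg c')).trans_le (ramp_le_four c'))
    (abs_activation'_sub_le b b') (abs_ramp_sub_le c c')
  rw [abs_le] at hpen hreward hnext ⊢
  constructor <;> linarith

theorem sum_range_sq_three_term_le {c : ℝ} (hc : 0 ≤ c) {u : ℕ → ℝ} {d : ℕ} (h0 : u 0 = 0)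
    (hd : u (d + 1) = 0) :
    ∑ j ∈ Finset.range d, (u j + c * u (j + 1) + u (j + 2)) ^ 2 ≤
      (c + 2) ^ 2 * ∑ j ∈ Finset.range d, u (j + 1) ^ 2 := by
  have hleft : ∑ j ∈ Finset.range d, u j ^ 2 ≤ ∑ j ∈ Finset.range d, u (j + 1) ^ 2 := by
    have := (Finset.sum_range_succ (fun j => u j ^ 2) d).symm.trans
      (Finset.sum_range_succ' (fun j => u j ^ 2) d)
    rw [h0] at this
    linarith [sq_nonneg (u d)]
  have hright : ∑ j ∈ Finset.range d, u (j + 2) ^ 2 ≤ ∑ j ∈ Finset.range d, u (j + 1) ^ 2 := by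
    have := (Finset.sum_range_succ (fun j => u (j + 1) ^ 2) d).symm.trans
      (Finset.sum_range_succ' (fun j => u (j + 1) ^ 2) d)
    rw [hd] at this
    linarith [sq_nonneg (u (0 + 1))]
  have hcauchy (j : ℕ) : (u j + c * u (j + 1) + u (j + 2)) ^ 2 ≤
      (c + 2) * (u j ^ 2 + c * u (j + 1) ^ 2 + u (j + 2) ^ 2) := by
    nlinarith [mul_nonneg hc (sq_nonneg (u j - u (j + 1))), sq_nonneg (u j - u (j + 2)),
      mul_nonneg hc (sq_nonneg (u (j + 2) - u (j + 1)))]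
  calc ∑ j ∈ Finset.range d, (u j + c * u (j + 1) + u (j + 2)) ^ 2
      ≤ ∑ j ∈ Finset.range d, (c + 2) * (u j ^ 2 + c * u (j + 1) ^ 2 + u (j + 2) ^ 2) :=
        Finset.sum_le_sum fun j _ => hcauchy j
    _ = (c + 2) * (∑ j ∈ Finset.range d, u j ^ 2 + c * ∑ j ∈ Finset.range d, u (j + 1) ^ 2 +
          ∑ j ∈ Finset.range d, u (j + 2) ^ 2) := by
        rw [← Finset.mul_sum, Finset.sum_add_distrib, Finset.sum_add_distrib, ← Finset.mul_sum]
    _ ≤ (c + 2) ^ 2 * ∑ j ∈ Finset.range d, u (j + 1) ^ 2 := by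
        rw [pow_two (c + 2), mul_assoc]
        gcongr
        linarith

theorem norm_chainGrad_sub_le (T : ℕ) (x y : Pt d) :
    ‖chainGrad T x - chainGrad T y‖ ≤ 12 * ‖x - y‖ := by
  set u : ℕ → ℝ := fun j => |chainSeq T x j - chainSeq T y j| with hu
  have hterm (i : Fin d) : ‖(chainGrad T x - chainGrad T y) i‖ ≤
      u i + 10 * u (i + 1) + u (i + 2) := by
    rw [PiLp.sub_apply, chainGrad_apply, chainGrad_apply]
    split_ifs with hi
    · exact abs_chainPartial_sub_le T x y i
    · rw [sub_zero, norm_zero]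
      positivity
  refine abs_le_of_sq_le_sq' ?_ (by positivity) |>.2
  calc ‖chainGrad T x - chainGrad T y‖ ^ 2
      ≤ ∑ j ∈ Finset.range d, (u j + 10 * u (j + 1) + u (j + 2)) ^ 2 := by
        rw [EuclideanSpace.norm_sq_eq, ← Fin.sum_univ_eq_sum_range
          (fun j => (u j + 10 * u (j + 1) + u (j + 2)) ^ 2)]
        exact Finset.sum_le_sum fun i _ => pow_le_pow_left₀ (norm_nonneg _) (hterm i) 2
    _ ≤ (10 + 2) ^ 2 * ∑ j ∈ Finset.range d, u (j + 1) ^ 2 :=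
        sum_range_sq_three_term_le (by norm_num) (by simp [hu]) (by simp [hu, chainSeq, chainCoord])
    _ ≤ (10 + 2) ^ 2 * ‖x - y‖ ^ 2 := by
        gcongr
        simpa only [hu, sq_abs] using sum_range_chainSeq_sub_sq_le T x y
    _ = (12 * ‖x - y‖) ^ 2 := by ring

theorem neg_le_chain (T : ℕ) (x : Pt d) : -(4 * ((T : ℝ) + 1)) ≤ chain T x := by
  have hterm (j : ℕ) : -4 ≤ penalty (chainSeq T x (j + 1)) -
      activation (chainSeq T x j) * ramp (chainSeq T x (j + 1)) := by
    have := penalty_nonneg (chainSeq T x (j + 1))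
    have := mul_le_mul (activation_le_one (chainSeq T x j)) (ramp_le_four (chainSeq T x (j + 1)))
      (ramp_nonneg _) zero_le_one
    linarith
  calc -(4 * ((T : ℝ) + 1)) = ∑ _j ∈ Finset.range (T + 1), (-4 : ℝ) := by
        simp only [Finset.sum_const, Finset.card_range, nsmul_eq_mul, Nat.cast_add, Nat.cast_one]
        ring
    _ ≤ chain T x := Finset.sum_le_sum fun j _ => hterm j

theorem chain_zero_nonpos (T : ℕ) : chain T (0 : Pt d) ≤ 0 := by
  refine Finset.sum_nonpos fun j _ => ?_
  rw [chainSeq_succ_eq_zero (suppLT_zero 0) (Nat.zero_le j), penalty_zero, zero_sub]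
  exact neg_nonpos.2 (mul_nonneg (activation_nonneg _) (ramp_nonneg 0))

-- The first link whose value is below `1` follows a link that is switched on, so its partial
-- derivative is large.
theorem quarter_le_norm_chainGrad {T : ℕ} (hT : T ≤ d) (x : Pt d) (hx : chainSeq T x T < 1) :
    1 / 4 ≤ ‖chainGrad T x‖ := by
  classical
  have hex : ∃ j, chainSeq T x j < 1 := ⟨T, hx⟩
  obtain ⟨i, hi⟩ : ∃ i, Nat.find hex = i + 1 := Nat.exists_eq_succ_of_ne_zero fun h =>
    (chainSeq_zero T x).not_lt (h ▸ Nat.find_spec hex)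
  have hnext : chainSeq T x (i + 1) < 1 := hi ▸ Nat.find_spec hex
  have hprev : 1 ≤ chainSeq T x i := not_lt.1 (Nat.find_min hex (by omega))
  have hiT : i < T := by
    have := Nat.find_min' hex hx
    omega
  have hdescent := quarter_le_activation_mul_ramp'_sub_penalty' hprev hnext
  have hafter := mul_nonneg (activation'_nonneg (chainSeq T x (i + 1)))
    (ramp_nonneg (chainSeq T x (i + 2)))
  calc 1 / 4 ≤ -chainPartial T x i := by rw [chainPartial]; linarith
    _ ≤ |chainPartial T x i| := neg_le_abs _
    _ = ‖chainGrad T x ⟨i, hiT.trans_le hT⟩‖ := by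
      rw [chainGrad_apply, if_pos hiT, Real.norm_eq_abs]
    _ ≤ ‖chainGrad T x‖ := PiLp.norm_apply_le _ _

theorem isZeroChain_chainGrad (T : ℕ) : IsZeroChain (chainGrad T : Pt d → Pt d) := by
  intro ℓ x hx i hi
  obtain ⟨j, hj⟩ : ∃ j, (i : ℕ) = j + 1 := Nat.exists_eq_succ_of_ne_zero (by omega)
  rw [chainGrad_apply, chainPartial, chainSeq_succ_eq_zero hx (by omega), hj,
    chainSeq_succ_eq_zero hx (by omega)]
  simp

theorem abs_chainGrad_apply_le_one (T : ℕ) {x : Pt d} {i : Fin d} (hx : SuppLT i x) :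
    |chainGrad T x i| ≤ 1 := by
  rw [chainGrad_apply, chainPartial, chainSeq_succ_eq_zero hx le_rfl]
  split_ifs
  · simp only [penalty'_zero, activation'_zero, zero_mul, sub_zero, zero_sub, abs_neg]
    rw [abs_of_nonneg (mul_nonneg (activation_nonneg _) (ramp'_nonneg _))]
    exact mul_le_one₀ (activation_le_one _) (ramp'_nonneg _) (ramp'_le_one _)
  · simp

/-! ### The hard function at the scale of the problem -/

theorem hasGradientAt_const_mul_comp_smul {E : Type*} [NormedAddCommGroup E]
    [InnerProductSpace ℝ E] [CompleteSpace E] {F : E → ℝ} {F' : E → E}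
    (hF : ∀ x, HasGradientAt F (F' x) x) (a b : ℝ) (x : E) :
    HasGradientAt (fun x => a * F (b • x)) ((a * b) • F' (b • x)) x := by
  rw [hasGradientAt_iff_hasFDerivAt]
  refine ((hF (b • x)).hasFDerivAt.comp x ((hasFDerivAt_id x).const_smul b)).const_mul a
    |>.congr_fderiv (ContinuousLinearMap.ext fun y => ?_)
  simp [mul_assoc]

/-- The chain of `T` coordinates, scaled to an `L`-Lipschitz gradient whose norm is at least
`2√ε` until the last coordinate of the chain is found. -/
def hardFun (L ε : ℝ) (T : ℕ) (x : Pt d) : ℝ := 768 * ε / L * chain T ((L / (96 * √ε)) • x)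

/-- The gradient of `hardFun`. -/
def hardGrad (L ε : ℝ) (T : ℕ) (x : Pt d) : Pt d :=
  (8 * √ε) • chainGrad T ((L / (96 * √ε)) • x)

section HardFunction

variable {L ε : ℝ} {T : ℕ}

theorem hasGradientAt_hardFun (hL : 0 < L) (hε : 0 < ε) (hT : T ≤ d) (x : Pt d) :
    HasGradientAt (hardFun L ε T) (hardGrad L ε T x) x := by
  have hscale : 768 * ε / L * (L / (96 * √ε)) = 8 * √ε := by
    have : 0 < √ε := Real.sqrt_pos.2 hε
    field_simp
    rw [Real.sq_sqrt hε.le]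
    ring
  rw [hardGrad, ← hscale]
  exact hasGradientAt_const_mul_comp_smul (hasGradientAt_chain hT) _ _ x

theorem gradient_hardFun (hL : 0 < L) (hε : 0 < ε) (hT : T ≤ d) :
    gradient (hardFun L ε T : Pt d → ℝ) = hardGrad L ε T :=
  gradient_eq (hasGradientAt_hardFun hL hε hT)

theorem norm_hardGrad_sub_le (hL : 0 < L) (hε : 0 < ε) (x y : Pt d) :
    ‖hardGrad L ε T x - hardGrad L ε T y‖ ≤ L * ‖x - y‖ := by
  have : 0 < √ε := Real.sqrt_pos.2 hε
  set b := L / (96 * √ε) with hb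
  calc ‖hardGrad L ε T x - hardGrad L ε T y‖
      = 8 * √ε * ‖chainGrad T (b • x) - chainGrad T (b • y)‖ := by
        rw [hardGrad, hardGrad, ← smul_sub, norm_smul, Real.norm_of_nonneg (by positivity)]
    _ ≤ 8 * √ε * (12 * ‖b • x - b • y‖) := by gcongr; exact norm_chainGrad_sub_le T _ _
    _ = 8 * √ε * (12 * (b * ‖x - y‖)) := by
        rw [← smul_sub, norm_smul, Real.norm_of_nonneg (by positivity)]
    _ = L * ‖x - y‖ := by rw [hb]; field_simp; norm_num

theorem isSmooth_hardFun (hL : 0 < L) (hε : 0 < ε) (hT : T ≤ d) :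
    IsSmooth L (hardFun L ε T : Pt d → ℝ) := by
  refine ⟨fun x => (hasGradientAt_hardFun hL hε hT x).differentiableAt, fun x y => ?_⟩
  rw [gradient_hardFun hL hε hT]
  exact norm_hardGrad_sub_le hL hε x y

theorem exists_le_hardFun_and_hardFun_zero_sub_le {Δ : ℝ} (hL : 0 < L) (hε : 0 < ε)
    (hΔ : 3072 * ε * ((T : ℝ) + 1) ≤ L * Δ) :
    ∃ m, (∀ x : Pt d, m ≤ hardFun L ε T x) ∧ hardFun L ε T (0 : Pt d) - m ≤ Δ := by
  have ha : 0 ≤ 768 * ε / L := by positivity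
  refine ⟨768 * ε / L * -(4 * ((T : ℝ) + 1)),
    fun x => mul_le_mul_of_nonneg_left (neg_le_chain T _) ha, ?_⟩
  calc hardFun L ε T (0 : Pt d) - 768 * ε / L * -(4 * ((T : ℝ) + 1))
      ≤ 0 - 768 * ε / L * -(4 * ((T : ℝ) + 1)) := by
        rw [hardFun, smul_zero]
        exact sub_le_sub_right (mul_nonpos_of_nonneg_of_nonpos ha (chain_zero_nonpos T)) _
    _ = 3072 * ε * ((T : ℝ) + 1) / L := by ring
    _ ≤ Δ := (div_le_iff₀' hL).2 hΔ

theorem four_mul_le_norm_hardGrad_sq (hε : 0 < ε) (hT : T + 1 ≤ d) {x : Pt d} (hx : SuppLT T x) :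
    4 * ε ≤ ‖hardGrad L ε (T + 1) x‖ ^ 2 := by
  have hlast : chainSeq (T + 1) ((L / (96 * √ε)) • x) (T + 1) < 1 := by
    rw [chainSeq_succ_eq_zero (hx.smul _) le_rfl]
    exact zero_lt_one
  have hnorm := quarter_le_norm_chainGrad hT _ hlast
  rw [hardGrad, norm_smul, Real.norm_of_nonneg (by positivity), mul_pow, mul_pow,
    Real.sq_sqrt hε.le]
  nlinarith [pow_le_pow_left₀ (by norm_num) hnorm 2]

theorem isZeroChain_hardGrad (L ε : ℝ) (T : ℕ) : IsZeroChain (hardGrad L ε T : Pt d → Pt d) :=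
  fun _ _ hx => (isZeroChain_chainGrad T (hx.smul _)).smul _

theorem hardGrad_apply_sq_le (hε : 0 ≤ ε) {x : Pt d} {i : Fin d} (hx : SuppLT i x) :
    hardGrad L ε T x i ^ 2 ≤ 64 * ε := by
  have h := (sq_le_one_iff_abs_le_one _).2
    (abs_chainGrad_apply_le_one T (hx.smul (L / (96 * √ε))))
  rw [hardGrad, PiLp.smul_apply, smul_eq_mul, mul_pow, mul_pow, Real.sq_sqrt hε]
  nlinarith

end HardFunction

/-! ### Bernoulli noise on the frontier coordinate -/

open Classical in
/-- The part of `y` in the coordinates beyond the last non-zero coordinate of `x`. -/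
def frontierPart (x y : Pt d) : Pt d := WithLp.toLp 2 fun i => if SuppLT i x then y i else 0

theorem frontierPart_apply_of_suppLT {x : Pt d} {i : Fin d} (hx : SuppLT i x) (y : Pt d) :
    frontierPart x y i = y i := if_pos hx

theorem frontierPart_apply_ne_zero {x y : Pt d} {i : Fin d} :
    frontierPart x y i ≠ 0 ↔ SuppLT i x ∧ y i ≠ 0 := by
  simp [frontierPart]

theorem IsZeroChain.eq_of_frontierPart_ne_zero {g : Pt d → Pt d} (hg : IsZeroChain g) {x : Pt d}
    {i j : Fin d} (hi : frontierPart x (g x) i ≠ 0) (hj : frontierPart x (g x) j ≠ 0) : i = j := by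
  rw [frontierPart_apply_ne_zero] at hi hj
  refine le_antisymm (not_lt.1 fun hlt => hi.2 ?_) (not_lt.1 fun hlt => hj.2 ?_)
  · exact hg hj.1 i hlt
  · exact hg hi.1 j hlt

theorem IsZeroChain.norm_frontierPart_sq_le {g : Pt d → Pt d} (hg : IsZeroChain g) {C : ℝ}
    (hC0 : 0 ≤ C) {x : Pt d} (hC : ∀ i : Fin d, SuppLT i x → g x i ^ 2 ≤ C) :
    ‖frontierPart x (g x)‖ ^ 2 ≤ C := by
  rw [EuclideanSpace.norm_sq_eq]
  by_cases hex : ∃ i, frontierPart x (g x) i ≠ 0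
  · obtain ⟨i, hi⟩ := hex
    have hsupp := (frontierPart_apply_ne_zero.1 hi).1
    rw [Finset.sum_eq_single i, Real.norm_eq_abs, sq_abs, frontierPart_apply_of_suppLT hsupp]
    · exact hC i hsupp
    · intro j _ hji
      rw [of_not_not fun hj => hji (hg.eq_of_frontierPart_ne_zero hj hi), norm_zero,
        zero_pow two_ne_zero]
    · simp
  · push Not at hex
    simpa [hex] using hC0

/-- The vector field `g` with its part beyond the support of the argument multiplied by a
Bernoulli variable of mean one, which is `1 / p` if `ξ` is `true` and `0` otherwise. -/
def noisy (g : Pt d → Pt d) (p : ℝ) (x : Pt d) (ξ : Bool) : Pt d :=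
  g x + (bif ξ then p⁻¹ - 1 else -1) • frontierPart x (g x)

theorem IsZeroChain.suppLT_noisy {g : Pt d → Pt d} (hg : IsZeroChain g) (p : ℝ) (ξ : Bool)
    {ℓ : ℕ} {x : Pt d} (hx : SuppLT ℓ x) : SuppLT (ℓ + 1) (noisy g p x ξ) := by
  intro i hi
  have hsupp : SuppLT i x := hx.mono (by omega)
  simp [noisy, frontierPart_apply_of_suppLT hsupp, hg hx i hi]

theorem suppLT_noisy_false (g : Pt d → Pt d) (p : ℝ) {ℓ : ℕ} {x : Pt d} (hx : SuppLT ℓ x) :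
    SuppLT ℓ (noisy g p x false) := by
  intro i hi
  simp [noisy, frontierPart_apply_of_suppLT (hx.mono hi)]

theorem integral_bernoulli_noisy (g : Pt d → Pt d) {p : unitInterval} (hp : (p : ℝ) ≠ 0)
    (x : Pt d) :
    ∫ ξ, noisy g p x ξ ∂ProbabilityTheory.bernoulliMeasure true false p = g x := by
  rw [ProbabilityTheory.integral_bernoulliMeasure]
  simp only [noisy, cond_true, cond_false]
  match_scalars <;> field

theorem integral_bernoulli_norm_noisy_sub_sq (g : Pt d → Pt d) {p : unitInterval}
    (hp : (p : ℝ) ≠ 0) (x : Pt d) :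
    ∫ ξ, ‖noisy g p x ξ - g x‖ ^ 2 ∂ProbabilityTheory.bernoulliMeasure true false p =
      (1 - p) / p * ‖frontierPart x (g x)‖ ^ 2 := by
  rw [ProbabilityTheory.integral_bernoulliMeasure]
  simp only [noisy, cond_true, cond_false, add_sub_cancel_left, norm_smul, mul_pow,
    Real.norm_eq_abs, sq_abs, smul_eq_mul]
  field

theorem isStochasticGradient_noisy {f : Pt d → ℝ} (hf : IsZeroChain (gradient f)) {C σ : ℝ}
    (hC0 : 0 ≤ C) (hC : ∀ (x : Pt d) (i : Fin d), SuppLT i x → gradient f x i ^ 2 ≤ C)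
    {p : unitInterval} (hp : (p : ℝ) ≠ 0) (hσ : (1 - p) / p * C ≤ σ ^ 2) :
    IsStochasticGradient (ProbabilityTheory.bernoulliMeasure true false p) f σ
      (noisy (gradient f) p) where
  integrable _ := .of_finite
  unbiased x := integral_bernoulli_noisy _ hp x
  integrable_sq _ := .of_finite
  variance_le x := by
    rw [integral_bernoulli_norm_noisy_sub_sq _ hp]
    refine (mul_le_mul_of_nonneg_left (hf.norm_frontierPart_sq_le hC0 (hC x)) ?_).trans hσ
    exact div_nonneg (sub_nonneg.2 p.2.2) p.2.1

/-! ### Computation work and the lower time sequence -/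

theorem work_mono_right (v : ℝ → ℝ) (s : ℝ≥0∞) {t t' : ℝ≥0∞} (h : t ≤ t') :
    work v s t ≤ work v s t' :=
  lintegral_mono_set fun _ hτ => ⟨hτ.1, hτ.2.trans h⟩

theorem work_anti_left (v : ℝ → ℝ) {s s' : ℝ≥0∞} (t : ℝ≥0∞) (h : s ≤ s') :
    work v s' t ≤ work v s t :=
  lintegral_mono_set fun _ hτ => ⟨h.trans_lt hτ.1, hτ.2⟩

theorem work_eq_zero (v : ℝ → ℝ) {s t : ℝ≥0∞} (h : t ≤ s) : work v s t = 0 := by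
  have hempty : {τ : ℝ | s < ENNReal.ofReal τ ∧ ENNReal.ofReal τ ≤ t} = ∅ :=
    Set.eq_empty_of_forall_notMem fun τ hτ => absurd (hτ.1.trans_le (hτ.2.trans h)) (lt_irrefl _)
  rw [work, hempty, Measure.restrict_empty, lintegral_zero_measure]

theorem work_add_le (v : ℝ → ℝ) {r s t : ℝ≥0∞} (hrs : r ≤ s) (hst : s ≤ t) :
    work v r s + work v s t ≤ work v r t := by
  have hmeas : MeasurableSet {τ : ℝ | s < ENNReal.ofReal τ ∧ ENNReal.ofReal τ ≤ t} :=
    (measurableSet_lt measurable_const ENNReal.measurable_ofReal).inter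
      (measurableSet_le ENNReal.measurable_ofReal measurable_const)
  rw [work, work, ← lintegral_union hmeas]
  · refine lintegral_mono_set ?_
    rintro τ (h | h)
    · exact ⟨h.1, h.2.trans hst⟩
    · exact ⟨hrs.trans_lt h.1, h.2⟩
  · rw [Set.disjoint_left]
    exact fun τ h h' => absurd (h'.1.trans_le h.2) (lt_irrefl _)

variable {n : ℕ}

theorem lowerTime_mono (v : Fin n → ℝ → ℝ) {M : ℝ} (hM : 0 < M) : Monotone (lowerTime v M) := by
  refine monotone_nat_of_le_succ fun k => le_sInf fun t ht => ?_
  by_contra! hlt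
  have hzero : ∑ i, ENat.floor (work (v i) (lowerTime v M k) t) = 0 :=
    Finset.sum_eq_zero fun i _ => by rw [work_eq_zero _ hlt.le, ENat.floor_zero]
  rw [Set.mem_ofPred_eq, hzero, ENat.toENNReal_zero, nonpos_iff_eq_zero,
    ENNReal.ofReal_eq_zero] at ht
  exact ht.not_gt hM

theorem lowerTime_succ_le {v : Fin n → ℝ → ℝ} {M : ℝ} {k : ℕ} {s t : ℝ≥0∞} {c : Fin n → ℕ}
    (hs : lowerTime v M k ≤ s) (hc : ∀ i, (c i : ℝ≥0∞) ≤ work (v i) s t)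
    (hM : M ≤ (∑ i, c i : ℕ)) : lowerTime v M (k + 1) ≤ t := by
  refine sInf_le ?_
  rw [Set.mem_ofPred_eq]
  calc ENNReal.ofReal M ≤ ENNReal.ofReal (∑ i, c i : ℕ) := ENNReal.ofReal_le_ofReal hM
    _ = ((∑ i, (c i : ℕ∞) : ℕ∞) : ℝ≥0∞) := by
        rw [ENNReal.ofReal_natCast, ← Nat.cast_sum, ENat.toENNReal_coe]
    _ ≤ _ := ENat.toENNReal_le.2 <| Finset.sum_le_sum fun i _ => ENat.le_floor.2 <| by
        simpa using (hc i).trans (work_anti_left _ _ hs)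

/-! ### The oracle -/

section Oracle

variable {Ξ : Type} (v : ℝ → ℝ) (g : Pt d → Ξ → ℝ≥0 → Pt d) (ξ : Ξ) {t : ℝ≥0} (x : Pt d)
  {s : OracleState d}

theorem oracle_cancel (t : ℝ≥0) (s : OracleState d) :
    oracle v g ξ t x s true = (OracleState.idle d, 0) := if_pos rfl

theorem oracle_of_idle (t : ℝ≥0) (hs : s.busy = false) :
    oracle v g ξ t x s false = (⟨t, x, true⟩, 0) := by
  simp [oracle, hs]

variable {v}

theorem oracle_of_work_lt_one (hs : s.busy = true) (hw : work v s.time t < 1) :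
    oracle v g ξ t x s false = (s, 0) := by
  simp [oracle, hs, hw]

theorem oracle_of_one_le_work (hs : s.busy = true) (hw : 1 ≤ work v s.time t) :
    oracle v g ξ t x s false = (OracleState.idle d, g s.point ξ t) := by
  simp [oracle, hs, hw.not_gt]

end Oracle

/-! ### The ledger of a run -/

/-- Bookkeeping along a run. A *trial* is a completed computation that was begun after the current
level was reached; a successful trial reveals a coordinate and starts the next level. -/
structure Ledger (n : ℕ) where
  /-- The number of levels completed so far. It bounds the number of coordinates revealed. -/
  level : ℕ
  /-- The time at which the current level was reached. -/
  start : ℝ≥0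
  /-- The number of completed levels that took many trials. -/
  long : ℕ
  /-- The number of failed trials of each worker in the current level. -/
  count : Fin n → ℕ

namespace Ledger

/-- The ledger before the first iteration. -/
def empty (n : ℕ) : Ledger n := ⟨0, 0, 0, 0⟩

/-- The number of failed trials in the current level. -/
def trials (l : Ledger n) : ℕ := ∑ i, l.count i

/-- The ledger after a failed trial of the worker `w`. -/
def fail (l : Ledger n) (w : Fin n) : Ledger n :=
  { l with count := Function.update l.count w (l.count w + 1) }

/-- The ledger after a successful trial at time `t`, where a level with at least `N` failed trials
counts as long. -/
def succeed (l : Ledger n) (N : ℕ) (t : ℝ≥0) : Ledger n :=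
  ⟨l.level + 1, t, if N ≤ l.trials then l.long + 1 else l.long, 0⟩

/-- The query completes a computation that was begun after the current level was reached. -/
def IsTrial (v : Fin n → ℝ → ℝ) (S : Fin n → OracleState d) (l : Ledger n) (q : Query n d) : Prop :=
  q.cancel = false ∧ (S q.worker).busy = true ∧
    1 ≤ work (v q.worker) (S q.worker).time q.time ∧ l.start ≤ (S q.worker).time

open Classical in
/-- The ledger after the query `q` in the states `S` with the sample `ξ`. -/
def step (v : Fin n → ℝ → ℝ) (N : ℕ) (S : Fin n → OracleState d) (l : Ledger n) (q : Query n d)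
    (ξ : Bool) : Ledger n :=
  if l.IsTrial v S q then bif ξ then l.succeed N q.time else l.fail q.worker else l

/-- A trial in one of the first `T` levels which, if it succeeds, completes a level that is not
long. -/
def IsEarlyTrial (v : Fin n → ℝ → ℝ) (N T : ℕ) (S : Fin n → OracleState d) (l : Ledger n)
    (q : Query n d) : Prop :=
  l.IsTrial v S q ∧ l.level < T ∧ l.trials < N

/-- The ledger agrees with the states `S` of the workers at time `now`. -/
structure Valid (v : Fin n → ℝ → ℝ) (M : ℝ) (S : Fin n → OracleState d) (now : ℝ≥0)
    (l : Ledger n) : Prop where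
  suppLT : ∀ i, (S i).busy = true → SuppLT l.level (S i).point
  exists_suppLT : ∀ i, (S i).busy = true → (S i).time < l.start →
    ∃ ℓ < l.level, SuppLT ℓ (S i).point
  start_le : l.start ≤ now
  start_pos : 0 < l.level → 0 < l.start
  lowerTime_le : lowerTime v M l.long ≤ l.start
  time_le : ∀ i, (S i).busy = true → (S i).time ≤ now
  count_le : ∀ i, (l.count i : ℝ≥0∞) ≤ work (v i) l.start now
  count_le_time : ∀ i, (S i).busy = true → l.start ≤ (S i).time →
    (l.count i : ℝ≥0∞) ≤ work (v i) l.start (S i).time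

section Step

variable {v : Fin n → ℝ → ℝ} {N : ℕ} {S : Fin n → OracleState d} {l : Ledger n} {q : Query n d}

theorem step_of_not_isTrial (h : ¬ l.IsTrial v S q) (ξ : Bool) : l.step v N S q ξ = l := if_neg h

theorem step_true (h : l.IsTrial v S q) : l.step v N S q true = l.succeed N q.time := if_pos h

theorem step_false (h : l.IsTrial v S q) : l.step v N S q false = l.fail q.worker := if_pos h

theorem trials_fail (l : Ledger n) (w : Fin n) : (l.fail w).trials = l.trials + 1 := by
  simp only [trials, fail]
  rw [Finset.sum_update_of_mem (Finset.mem_univ w), ← Finset.add_sum_erase _ _ (Finset.mem_univ w),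
    Finset.sdiff_singleton_eq_erase]
  ring

theorem level_le_step (v : Fin n → ℝ → ℝ) (N : ℕ) (S : Fin n → OracleState d) (l : Ledger n)
    (q : Query n d) (ξ : Bool) : l.level ≤ (l.step v N S q ξ).level := by
  by_cases ht : l.IsTrial v S q
  · cases ξ
    · rw [step_false ht, fail]
    · rw [step_true ht]
      exact Nat.le_succ _
  · rw [step_of_not_isTrial ht]

end Step

section Progress

variable (v : Fin n → ℝ → ℝ) (N T : ℕ) (S : Fin n → OracleState d) (l : Ledger n) (q : Query n d)
  (ξ : Bool)

/-- A potential that counts the early trials, at most `N` for each of the first `T` levels. -/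
def progress : ℕ := min (l.level * N + min l.trials N) (T * N)

open Classical in
theorem progress_add_le_progress_step :
    l.progress N T + (if l.IsEarlyTrial v N T S q then 1 else 0) ≤
      (l.step v N S q ξ).progress N T := by
  by_cases ht : l.IsTrial v S q
  swap
  · simp [IsEarlyTrial, ht, step_of_not_isTrial ht]
  have hlevel : l.level < T → (l.level + 1) * N ≤ T * N := Nat.mul_le_mul_right N
  have hearly : (if l.IsEarlyTrial v N T S q then 1 else 0) =
      if l.level < T ∧ l.trials < N then 1 else 0 := by simp [IsEarlyTrial, ht]
  have hlate : ¬ l.level < T → T * N ≤ l.level * N := fun h => Nat.mul_le_mul_right N (not_lt.1 h)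
  rw [hearly]
  cases ξ
  · rw [step_false ht, progress, progress, trials_fail, fail]
    split_ifs <;> grind
  · rw [step_true ht, progress, progress, succeed]
    split_ifs <;> grind

open Classical in
theorem min_level_step_le :
    min (l.step v N S q ξ).level T + l.long ≤ min l.level T + (l.step v N S q ξ).long +
      if l.IsEarlyTrial v N T S q ∧ ξ = true then 1 else 0 := by
  by_cases ht : l.IsTrial v S q
  swap
  · simp [step_of_not_isTrial ht]
  cases ξ
  · simp [step_false ht, fail]
  · simp only [step_true ht, succeed, IsEarlyTrial, ht, true_and, and_true]
    split_ifs <;> omega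

end Progress

section Valid

variable {v : Fin n → ℝ → ℝ} {M : ℝ} {S : Fin n → OracleState d} {now : ℝ≥0} {l : Ledger n}

theorem valid_empty (v : Fin n → ℝ → ℝ) (M : ℝ) :
    (empty n).Valid v M (fun _ => OracleState.idle d) 0 := by
  constructor <;> simp [empty, OracleState.idle, lowerTime]

theorem Valid.mono (h : l.Valid v M S now) {t : ℝ≥0} (ht : now ≤ t) : l.Valid v M S t :=
  { h with
    start_le := h.start_le.trans ht
    count_le := fun i => (h.count_le i).trans (work_mono_right _ _ (by exact_mod_cast ht))
    time_le := fun i hi => (h.time_le i hi).trans ht }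

theorem ne_of_busy_update_idle {w i : Fin n}
    (hi : (Function.update S w (OracleState.idle d) i).busy = true) : i ≠ w := by
  rintro rfl
  simp [OracleState.idle] at hi

theorem Valid.idle (h : l.Valid v M S now) (w : Fin n) :
    l.Valid v M (Function.update S w (OracleState.idle d)) now := by
  refine { h with suppLT := ?_, exists_suppLT := ?_, time_le := ?_, count_le_time := ?_ }
  all_goals
    intro i hi
    have hw := ne_of_busy_update_idle hi
    rw [Function.update_of_ne hw] at hi ⊢
  · exact h.suppLT i hi
  · exact h.exists_suppLT i hi
  · exact h.time_le i hi
  · exact h.count_le_time i hi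

theorem Valid.begin (h : l.Valid v M S now) (w : Fin n) {x : Pt d} (hx : SuppLT l.level x) :
    l.Valid v M (Function.update S w ⟨now, x, true⟩) now := by
  refine { h with suppLT := ?_, exists_suppLT := ?_, time_le := ?_, count_le_time := ?_ }
  all_goals
    intro i
    rcases eq_or_ne i w with rfl | hw
    · simp [hx, h.start_le, h.count_le]
    rw [Function.update_of_ne hw]
  · exact h.suppLT i
  · exact h.exists_suppLT i
  · exact h.time_le i
  · exact h.count_le_time i

variable {q : Query n d}

theorem Valid.count_fail_le (h : l.Valid v M S now) (hq : now ≤ q.time) (ht : l.IsTrial v S q)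
    (i : Fin n) : ((l.fail q.worker).count i : ℝ≥0∞) ≤ work (v i) l.start q.time := by
  simp only [Ledger.fail]
  rcases eq_or_ne i q.worker with rfl | hw
  · obtain ⟨-, hbusy, hwork, hstart⟩ := ht
    rw [Function.update_self, Nat.cast_add_one]
    refine (add_le_add (h.count_le_time _ hbusy hstart) hwork).trans (work_add_le _ ?_ ?_)
    · exact_mod_cast hstart
    · exact_mod_cast (h.time_le _ hbusy).trans hq
  · rw [Function.update_of_ne hw]
    exact (h.mono hq).count_le i

theorem Valid.fail (h : l.Valid v M S now) (hq : now ≤ q.time) (ht : l.IsTrial v S q) :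
    (l.fail q.worker).Valid v M (Function.update S q.worker (OracleState.idle d)) q.time :=
  { (h.mono hq).idle q.worker with
    count_le := h.count_fail_le hq ht
    count_le_time := fun i hi => by
      have hw := ne_of_busy_update_idle hi
      rw [Function.update_of_ne hw] at hi ⊢
      simpa only [Ledger.fail, Function.update_of_ne hw] using h.count_le_time i hi }

theorem IsTrial.time_pos (ht : l.IsTrial v S q) : 0 < q.time := by
  rw [pos_iff_ne_zero]
  intro hzero
  have hwork := ht.2.2.1
  rw [hzero, work_eq_zero _ (by simp)] at hwork
  simp at hwork

theorem Valid.succeed (h : l.Valid v M S now) (hq : now ≤ q.time) (ht : l.IsTrial v S q) {N : ℕ}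
    (hN : M ≤ N + 1) :
    (l.succeed N q.time).Valid v M (Function.update S q.worker (OracleState.idle d)) q.time where
  suppLT i hi := ((h.idle q.worker).suppLT i hi).mono (Nat.le_succ _)
  exists_suppLT i hi _ := ⟨l.level, Nat.lt_succ_self _, (h.idle q.worker).suppLT i hi⟩
  start_le := le_rfl
  start_pos _ := ht.time_pos
  lowerTime_le := by
    simp only [Ledger.succeed]
    split_ifs with hlong
    · refine lowerTime_succ_le h.lowerTime_le (h.count_fail_le hq ht) (hN.trans ?_)
      rw [← trials, trials_fail]
      exact_mod_cast Nat.succ_le_succ hlong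
    · exact h.lowerTime_le.trans (by exact_mod_cast h.start_le.trans hq)
  time_le := ((h.mono hq).idle q.worker).time_le
  count_le i := by simp [Ledger.succeed]
  count_le_time i _ _ := by simp [Ledger.succeed]

end Valid

end Ledger

/-- Stochastic gradient mappings that reveal at most the next coordinate, and nothing new if the
sample is `false`. -/
structure RevealsNext (g : Fin n → Pt d → Bool → ℝ≥0 → Pt d) : Prop where
  suppLT : ∀ i {ℓ x}, SuppLT ℓ x → ∀ ξ t, SuppLT (ℓ + 1) (g i x ξ t)
  suppLT_false : ∀ i {ℓ x}, SuppLT ℓ x → ∀ t, SuppLT ℓ (g i x false t)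

theorem Ledger.Valid.step {v : Fin n → ℝ → ℝ} {M : ℝ} {S : Fin n → OracleState d} {now : ℝ≥0}
    {l : Ledger n} (h : l.Valid v M S now) {q : Query n d} (hq : now ≤ q.time)
    (hx : SuppLT l.level q.point) {N : ℕ} (hN : M ≤ N + 1)
    {g : Fin n → Pt d → Bool → ℝ≥0 → Pt d} (hg : RevealsNext g) (ξ : Bool) :
    let o := oracle (v q.worker) (g q.worker) ξ q.time q.point (S q.worker) q.cancel
    (l.step v N S q ξ).Valid v M (Function.update S q.worker o.1) q.time ∧
      SuppLT (l.step v N S q ξ).level o.2 := by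
  intro o
  by_cases ht : l.IsTrial v S q
  · obtain ⟨hcancel, hbusy, hwork, -⟩ := id ht
    simp only [o, hcancel, oracle_of_one_le_work _ _ _ hbusy hwork]
    have hsupp := h.suppLT _ hbusy
    cases ξ
    · rw [step_false ht]
      exact ⟨h.fail hq ht, hg.suppLT_false _ hsupp _⟩
    · rw [step_true ht]
      exact ⟨h.succeed hq ht hN, hg.suppLT _ hsupp _ _⟩
  rw [step_of_not_isTrial ht]
  rcases hcancel : q.cancel with _ | _
  swap
  · simp only [o, hcancel, oracle_cancel]
    exact ⟨(h.mono hq).idle _, suppLT_zero _⟩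
  rcases hbusy : (S q.worker).busy with _ | _
  · simp only [o, hcancel, oracle_of_idle _ _ _ _ _ hbusy]
    exact ⟨(h.mono hq).begin _ hx, suppLT_zero _⟩
  rcases lt_or_ge (work (v q.worker) (S q.worker).time q.time) 1 with hwork | hwork
  · simp only [o, hcancel, oracle_of_work_lt_one _ _ _ hbusy hwork, Function.update_eq_self]
    exact ⟨h.mono hq, suppLT_zero _⟩
  · simp only [o, hcancel, oracle_of_one_le_work _ _ _ hbusy hwork]
    have hstale : (S q.worker).time < l.start :=
      not_le.1 fun hstart => ht ⟨hcancel, hbusy, hwork, hstart⟩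
    obtain ⟨ℓ, hℓ, hsupp⟩ := h.exists_suppLT _ hbusy hstale
    exact ⟨(h.mono hq).idle _, (hg.suppLT _ hsupp _ _).mono hℓ⟩

/-! ### The ledger along the protocol -/

section Protocol

variable {Ξ : Type} (v : Fin n → ℝ → ℝ) (g : Fin n → Pt d → Ξ → ℝ≥0 → Pt d) (A : Algorithm n d)

/-- The states of the workers before iteration `k`. -/
def states (ω : ℕ → Ξ) (k : ℕ) : Fin n → OracleState d := (run v g A ω k).1

/-- The query of iteration `k`. -/
def query (ω : ℕ → Ξ) (k : ℕ) : Query n d := A k (run v g A ω k).2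

variable {v g A}

theorem iterTime_le_query_time (hA : A.IsZeroRespecting) (ω : ℕ → Ξ) (k : ℕ) :
    iterTime v g A ω k ≤ (query v g A ω k).time := by
  cases k with
  | zero => exact zero_le
  | succ k => simpa [run, iterTime, query] using hA.time_mono k (run v g A ω (k + 1)).2

theorem Algorithm.IsZeroRespecting.suppLT (hA : A.IsZeroRespecting) {k ℓ : ℕ} {y : Fin k → Pt d}
    (hy : ∀ j, SuppLT ℓ (y j)) : SuppLT ℓ (A k y).point := fun i hi => by
  by_contra hne
  obtain ⟨j, hj⟩ := hA.supp_subset k y i hne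
  exact hj (hy j i hi)

end Protocol

section LedgerOfRun

variable (v : Fin n → ℝ → ℝ) (g : Fin n → Pt d → Bool → ℝ≥0 → Pt d) (A : Algorithm n d) (N T : ℕ)

/-- The ledger before iteration `k`. -/
def ledger (ω : ℕ → Bool) : ℕ → Ledger n
  | 0 => Ledger.empty n
  | k + 1 => (ledger ω k).step v N (states v g A ω k) (query v g A ω k) (ω k)

/-- The event that iteration `k` is an early trial. -/
def earlyTrial (k : ℕ) : Set (ℕ → Bool) :=
  {ω | (ledger v g A N ω k).IsEarlyTrial v N T (states v g A ω k) (query v g A ω k)}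

/-- The event that iteration `k` is a successful early trial. -/
def earlySuccess (k : ℕ) : Set (ℕ → Bool) := earlyTrial v g A N T k ∩ Function.eval k ⁻¹' {true}

open Classical in
theorem count_earlyTrial_le (ω : ℕ → Bool) (k : ℕ) :
    Nat.count (fun j => ω ∈ earlyTrial v g A N T j) k ≤ T * N := by
  suffices h : Nat.count (fun j => ω ∈ earlyTrial v g A N T j) k ≤
      (ledger v g A N ω k).progress N T from h.trans (min_le_right _ _)
  induction k with
  | zero => simp
  | succ k ih =>
    rw [Nat.count_succ]
    exact (Nat.add_le_add_right ih _).trans (Ledger.progress_add_le_progress_step ..)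

open Classical in
theorem min_level_le_long_add_count (ω : ℕ → Bool) (k : ℕ) :
    min (ledger v g A N ω k).level T ≤
      (ledger v g A N ω k).long + Nat.count (fun j => ω ∈ earlySuccess v g A N T j) k := by
  induction k with
  | zero => simp [ledger, Ledger.empty]
  | succ k ih =>
    have hstep := Ledger.min_level_step_le v N T (states v g A ω k) (ledger v g A N ω k)
      (query v g A ω k) (ω k)
    have hmem : ω ∈ earlySuccess v g A N T k ↔ (ledger v g A N ω k).IsEarlyTrial v N T
      (states v g A ω k) (query v g A ω k) ∧ ω k = true := Iff.rfl
    simp only [Nat.count_succ, ledger, hmem]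
    omega

variable {v g A N}

theorem valid_ledger (hA : A.IsZeroRespecting) (hg : RevealsNext g) {M : ℝ} (hN : M ≤ N + 1)
    (ω : ℕ → Bool) (k : ℕ) :
    (ledger v g A N ω k).Valid v M (states v g A ω k) (iterTime v g A ω k) ∧
      ∀ j, SuppLT (ledger v g A N ω k).level ((run v g A ω k).2 j) := by
  induction k with
  | zero => exact ⟨Ledger.valid_empty v M, fun j => j.elim0⟩
  | succ k ih =>
    obtain ⟨hvalid, hsupp⟩ := ih
    have hstep := hvalid.step (iterTime_le_query_time hA ω k) (hA.suppLT hsupp) hN hg (ω k)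
    refine ⟨hstep.1, fun j => ?_⟩
    refine Fin.lastCases ?_ (fun j => ?_) j
    · simp only [run, Fin.snoc_last]
      exact hstep.2
    · simp only [run, Fin.snoc_castSucc]
      exact (hsupp j).mono (Ledger.level_le_step ..)

theorem suppLT_iterPoint (hA : A.IsZeroRespecting) (hg : RevealsNext g) (ω : ℕ → Bool) (k : ℕ) :
    SuppLT (ledger v g A N ω k).level (iterPoint v g A ω k) :=
  hA.suppLT (valid_ledger hA hg le_rfl ω k).2

end LedgerOfRun

/-! ### Events that depend on finitely many samples -/

section DependsOn

variable {ι : Type*} {X : ι → Type*} {s : Finset ι}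

theorem eq_comp_updateFinset_restrict [DecidableEq ι] {α : Type*} {F : (∀ i, X i) → α}
    (hF : DependsOn F s) (x : ∀ i, X i) :
    F = (fun y => F (Function.updateFinset x s y)) ∘ s.restrict :=
  funext fun ω => hF fun i hi => by simp [Function.updateFinset, Finset.mem_coe.1 hi]

variable [∀ i, MeasurableSpace (X i)]

theorem measurable_of_dependsOn [∀ i, Countable (X i)] [∀ i, MeasurableSingletonClass (X i)]
    {α : Type*} [MeasurableSpace α] {F : (∀ i, X i) → α} (hF : DependsOn F s) : Measurable F := by
  classical
  rcases isEmpty_or_nonempty (∀ i, X i) with _ | ⟨⟨x⟩⟩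
  · exact measurable_of_empty F
  · rw [eq_comp_updateFinset_restrict hF x]
    exact Measurable.of_discrete.comp (Finset.measurable_restrict s)

theorem infinitePi_inter_preimage_eval (μ : ∀ i, Measure (X i)) [∀ i, IsProbabilityMeasure (μ i)]
    {E : Set (∀ i, X i)} (hE : MeasurableSet E) (hs : DependsOn (· ∈ E) s) {k : ι} (hk : k ∉ s)
    {B : Set (X k)} (hB : MeasurableSet B) :
    Measure.infinitePi μ (E ∩ Function.eval k ⁻¹' B) = Measure.infinitePi μ E * μ k B := by
  classical
  obtain ⟨x⟩ := (Measure.infinitePi μ).nonempty_of_neZero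
  have hpre : E = s.restrict ⁻¹' {y | Function.updateFinset x s y ∈ E} :=
    congrArg Set.ofPred (eq_comp_updateFinset_restrict hs x)
  have hindep := (ProbabilityTheory.iIndepFun_infinitePi (P := μ) (X := fun _ y => y)
    (fun _ => measurable_id)).indepFun_finset s {k} (by simpa using hk)
    (fun i => measurable_pi_apply i)
  have hmul := hindep.measure_inter_preimage_eq_mul {y | Function.updateFinset x s y ∈ E}
    ((fun y => y ⟨k, Finset.mem_singleton_self k⟩) ⁻¹' B) (measurable_updateFinset hE)
    (measurable_pi_apply _ hB)
  rw [← (measurePreserving_eval_infinitePi μ k).measure_preimage hB.nullMeasurableSet]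
  nth_rw 1 2 [hpre]
  exact hmul

end DependsOn

section Wald

variable {Ξ : Type*} [MeasurableSpace Ξ] {E : ℕ → Set (ℕ → Ξ)}

open Classical in
theorem sum_range_indicator_one {α : Type*} (E : ℕ → Set α) (ω : α) (k : ℕ) :
    ∑ j ∈ Finset.range k, (E j).indicator (1 : α → ℝ≥0∞) ω =
      Nat.count (fun j => ω ∈ E j) k := by
  simp [Set.indicator_apply, Nat.count_eq_card_filter_range]

open Classical in
theorem tsum_indicator_one_le {α : Type*} {E : ℕ → Set α} {ω : α} {C : ℕ}
    (hC : ∀ k, Nat.count (fun j => ω ∈ E j) k ≤ C) :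
    ∑' k, (E k).indicator (1 : α → ℝ≥0∞) ω ≤ C :=
  ENNReal.tsum_le_of_sum_range_le fun k => by
    rw [sum_range_indicator_one]
    exact_mod_cast hC k

/-- A form of Wald's inequality: whether the `k`-th sample is counted is decided before it is
drawn. -/
theorem lintegral_tsum_indicator_inter_preimage_eval_le (D : Measure Ξ) [IsProbabilityMeasure D]
    (hE : ∀ k, MeasurableSet (E k)) (hdep : ∀ k, DependsOn (· ∈ E k) (Set.Iio k)) {B : Set Ξ}
    (hB : MeasurableSet B) {C : ℝ≥0∞} (hC : ∀ ω, ∑' k, (E k).indicator 1 ω ≤ C) :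
    ∫⁻ ω, ∑' k, (E k ∩ Function.eval k ⁻¹' B).indicator 1 ω ∂Measure.infinitePi (fun _ => D) ≤
      C * D B := by
  set μ := Measure.infinitePi fun _ : ℕ => D
  have hEB (k : ℕ) : MeasurableSet (E k ∩ Function.eval k ⁻¹' B) :=
    (hE k).inter (measurable_pi_apply k hB)
  calc ∫⁻ ω, ∑' k, (E k ∩ Function.eval k ⁻¹' B).indicator 1 ω ∂μ
      = ∑' k, μ (E k ∩ Function.eval k ⁻¹' B) := by
        rw [lintegral_tsum fun k => (measurable_one.indicator (hEB k)).aemeasurable]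
        exact tsum_congr fun k => lintegral_indicator_one (hEB k)
    _ = ∑' k, μ (E k) * D B := tsum_congr fun k =>
        infinitePi_inter_preimage_eval (s := Finset.range k) _ (hE k)
          (by simpa using hdep k) (by simp) hB
    _ = (∫⁻ ω, ∑' k, (E k).indicator 1 ω ∂μ) * D B := by
        rw [ENNReal.tsum_mul_right,
          lintegral_tsum fun k => (measurable_one.indicator (hE k)).aemeasurable]
        simp only [lintegral_indicator_one (hE _)]
    _ ≤ (∫⁻ _, C ∂μ) * D B := by
        gcongr with ω
        exact hC ω
    _ = C * D B := by rw [lintegral_const, measure_univ, mul_one]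

end Wald

section Dependence

variable {Ξ : Type} (v : Fin n → ℝ → ℝ)

theorem dependsOn_run (g : Fin n → Pt d → Ξ → ℝ≥0 → Pt d) (A : Algorithm n d) (k : ℕ) :
    DependsOn (fun ω => run v g A ω k) (Set.Iio k) := by
  intro ω ω' h
  induction k with
  | zero => rfl
  | succ k ih =>
    have hrun : run v g A ω k = run v g A ω' k := ih fun j hj => h j (Nat.lt_succ_of_lt hj)
    simp only [run, hrun, h k k.lt_succ_self]

theorem dependsOn_iterTime (g : Fin n → Pt d → Ξ → ℝ≥0 → Pt d) (A : Algorithm n d) (k : ℕ) :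
    DependsOn (fun ω => iterTime v g A ω k) (Set.Iio k) := by
  intro ω ω' h
  cases k with
  | zero => rfl
  | succ k =>
    have hrun : run v g A ω k = run v g A ω' k :=
      dependsOn_run v g A k fun j hj => h j (Nat.lt_succ_of_lt hj)
    simp only [iterTime, hrun]

theorem measurable_bestGradSq [Countable Ξ] [MeasurableSpace Ξ] [MeasurableSingletonClass Ξ]
    (g : Fin n → Pt d → Ξ → ℝ≥0 → Pt d) (A : Algorithm n d) (f : Pt d → ℝ) (t : ℝ≥0∞) :
    Measurable (bestGradSq v g A f t) := by
  refine Measurable.iInf fun k => measurable_of_dependsOn (s := Finset.range k) ?_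
  rw [Finset.coe_range]
  intro ω ω' h
  have hrun : run v g A ω k = run v g A ω' k := dependsOn_run v g A k h
  have htime : iterTime v g A ω k = iterTime v g A ω' k := dependsOn_iterTime v g A k h
  simp only [Set.mem_ofPred_eq, iterPoint, hrun, htime]

theorem dependsOn_ledger (g : Fin n → Pt d → Bool → ℝ≥0 → Pt d) (A : Algorithm n d) (N k : ℕ) :
    DependsOn (fun ω => ledger v g A N ω k) (Set.Iio k) := by
  intro ω ω' h
  induction k with
  | zero => rfl
  | succ k ih =>
    have hlt : ∀ j ∈ Set.Iio k, ω j = ω' j := fun j hj => h j (Nat.lt_succ_of_lt hj)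
    have hrun : run v g A ω k = run v g A ω' k := dependsOn_run v g A k hlt
    have hledger : ledger v g A N ω k = ledger v g A N ω' k := ih hlt
    simp only [ledger, states, query, hrun, hledger, h k k.lt_succ_self]

theorem dependsOn_mem_earlyTrial (g : Fin n → Pt d → Bool → ℝ≥0 → Pt d) (A : Algorithm n d)
    (N T k : ℕ) : DependsOn (· ∈ earlyTrial v g A N T k) (Set.Iio k) := by
  intro ω ω' h
  have hrun : run v g A ω k = run v g A ω' k := dependsOn_run v g A k h
  have hledger : ledger v g A N ω k = ledger v g A N ω' k := dependsOn_ledger v g A N k h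
  simp only [earlyTrial, Set.mem_ofPred_eq, states, query, hrun, hledger]

end Dependence

/-! ### The number of short levels -/

section ShortLevels

variable (v : Fin n → ℝ → ℝ) (g : Fin n → Pt d → Bool → ℝ≥0 → Pt d) (A : Algorithm n d) (N T : ℕ)

/-- The number of levels among the first `T` that are completed but not long. -/
def shortLevels (ω : ℕ → Bool) : ℝ≥0∞ := ∑' k, (earlySuccess v g A N T k).indicator 1 ω

theorem measurableSet_earlyTrial (k : ℕ) : MeasurableSet (earlyTrial v g A N T k) := by
  refine measurableSet_setOfPred.2 (measurable_of_dependsOn (s := Finset.range k) ?_)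
  rw [Finset.coe_range]
  exact dependsOn_mem_earlyTrial v g A N T k

theorem measurable_shortLevels : Measurable (shortLevels v g A N T) :=
  Measurable.tsum fun k => measurable_one.indicator <|
    (measurableSet_earlyTrial v g A N T k).inter (measurable_pi_apply k (measurableSet_singleton _))

theorem lintegral_shortLevels_le (D : Measure Bool) [IsProbabilityMeasure D] :
    ∫⁻ ω, shortLevels v g A N T ω ∂(Measure.infinitePi fun _ => D) ≤ (T * N : ℕ) * D {true} :=
  lintegral_tsum_indicator_inter_preimage_eval_le D (measurableSet_earlyTrial v g A N T)
    (dependsOn_mem_earlyTrial v g A N T) (measurableSet_singleton _)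
    fun ω => tsum_indicator_one_le (count_earlyTrial_le v g A N T ω)

variable {N T}

theorem half_le_measure_shortLevels_lt (D : Measure Bool) [IsProbabilityMeasure D] (hT : 0 < T)
    (hN : N * D {true} ≤ 1 / 4) :
    1 / 2 ≤ Measure.infinitePi (fun _ => D) {ω | shortLevels v g A N T ω < T / 2} := by
  set μ := Measure.infinitePi fun _ : ℕ => D
  have hmean : (T * N : ℕ) * D {true} ≤ (T / 2 * (1 / 2) : ℝ≥0∞) :=
    calc (T * N : ℕ) * D {true} = T * (N * D {true}) := by rw [Nat.cast_mul, mul_assoc]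
      _ ≤ T * (1 / 4) := by gcongr
      _ = T / 2 * (1 / 2) := by
        rw [one_div, one_div, div_eq_mul_inv, mul_assoc, ← ENNReal.mul_inv (by simp) (by simp)]
        norm_num
  have hmarkov : μ {ω | T / 2 ≤ shortLevels v g A N T ω} ≤ 1 / 2 := by
    refine (ENNReal.mul_le_mul_iff_right (a := T / 2) ?_ ?_).1 <|
      (mul_meas_ge_le_lintegral (measurable_shortLevels v g A N T) _).trans <|
        (lintegral_shortLevels_le v g A N T D).trans hmean
    · simp [hT.ne']
    · finiteness
  have hcompl : {ω | shortLevels v g A N T ω < T / 2} =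
      {ω | T / 2 ≤ shortLevels v g A N T ω}ᶜ := by
    ext ω
    simp
  rw [hcompl, prob_compl_eq_one_sub (measurableSet_le measurable_const
    (measurable_shortLevels v g A N T))]
  calc (1 / 2 : ℝ≥0∞) = 1 - 1 / 2 := by simp [ENNReal.one_sub_inv_two]
    _ ≤ _ := tsub_le_tsub_left hmarkov 1

end ShortLevels

section LowerBound

variable {v : Fin n → ℝ → ℝ} {g : Fin n → Pt d → Bool → ℝ≥0 → Pt d} {A : Algorithm n d} {N T : ℕ}

open Classical in
theorem two_mul_count_earlySuccess_lt {ω : ℕ → Bool} (hω : shortLevels v g A N T ω < T / 2)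
    (k : ℕ) : 2 * Nat.count (fun j => ω ∈ earlySuccess v g A N T j) k < T := by
  have hsum := (ENNReal.sum_le_tsum (Finset.range k)).trans_lt hω
  rw [sum_range_indicator_one, ENNReal.lt_div_iff_mul_lt (by simp) (by simp), mul_comm] at hsum
  exact_mod_cast hsum

theorem level_lt_of_shortLevels_lt (hA : A.IsZeroRespecting) (hg : RevealsNext g) {M : ℝ}
    (hM : 0 < M) (hN : M ≤ N + 1) {K : ℕ} (hK : 2 * K ≤ T) {ω : ℕ → Bool}
    (hω : shortLevels v g A N T ω < T / 2) {k : ℕ}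
    (hk : (iterTime v g A ω k : ℝ≥0∞) ≤ lowerTime v M K / 2) :
    (ledger v g A N ω k).level < T := by
  classical
  by_contra! hlevel
  have hvalid := (valid_ledger (v := v) hA hg hN ω k).1
  have hshort := two_mul_count_earlySuccess_lt hω k
  have hlong : K ≤ (ledger v g A N ω k).long := by
    have := min_level_le_long_add_count v g A N T ω k
    omega
  have hlower : lowerTime v M K ≤ iterTime v g A ω k :=
    (lowerTime_mono v hM hlong).trans
      (hvalid.lowerTime_le.trans (by exact_mod_cast hvalid.start_le))
  have hpos : 0 < iterTime v g A ω k := (hvalid.start_pos (by omega)).trans_le hvalid.start_le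
  have hhalf : (iterTime v g A ω k : ℝ≥0∞) ≤ iterTime v g A ω k / 2 :=
    hk.trans (ENNReal.div_le_div_right hlower 2)
  exact hhalf.not_gt (ENNReal.half_lt_self (by exact_mod_cast hpos.ne') ENNReal.coe_ne_top)

theorem lt_lintegral_bestGradSq (hA : A.IsZeroRespecting) (hg : RevealsNext g) {f : Pt d → ℝ}
    {ε M : ℝ} {K : ℕ} (hε : 0 < ε) {D : Measure Bool} [IsProbabilityMeasure D] (hM : 0 < M)
    (hMD : D.real {true} * M ≤ 1 / 4) (hK : 2 * K ≤ T + 1)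
    (hf : ∀ x, SuppLT T x → 4 * ε ≤ ‖gradient f x‖ ^ 2) :
    ENNReal.ofReal ε < ∫⁻ ω, bestGradSq v g A f (lowerTime v M K / 2) ω
      ∂(Measure.infinitePi fun _ : ℕ => D) := by
  have hfew : ⌊M⌋₊ * D {true} ≤ 1 / 4 := by
    rw [← ofReal_measureReal, ← ENNReal.ofReal_natCast, ← ENNReal.ofReal_mul (by positivity),
      ENNReal.ofReal_le_iff_le_toReal (by simp)]
    calc ⌊M⌋₊ * D.real {true} ≤ M * D.real {true} := by gcongr; exact Nat.floor_le hM.le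
      _ ≤ (1 / 4 : ℝ≥0∞).toReal := by simpa [mul_comm] using hMD
  have hbest : {ω | shortLevels v g A ⌊M⌋₊ (T + 1) ω < (T + 1 : ℕ) / 2} ⊆
      {ω | ENNReal.ofReal (4 * ε) ≤ bestGradSq v g A f (lowerTime v M K / 2) ω} := by
    intro ω hω
    refine le_iInf₂ fun k hk => ENNReal.ofReal_le_ofReal (hf _ ?_)
    have hlevel := level_lt_of_shortLevels_lt hA hg hM (Nat.lt_floor_add_one M).le hK hω hk
    exact (suppLT_iterPoint hA hg ω k).mono (Nat.lt_succ_iff.1 hlevel)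
  have hhalf := (half_le_measure_shortLevels_lt v g A D T.succ_pos hfew).trans (measure_mono hbest)
  calc ENNReal.ofReal ε < ENNReal.ofReal (4 * ε * (1 / 2)) :=
        (ENNReal.ofReal_lt_ofReal_iff (by positivity)).2 (by linarith)
    _ = ENNReal.ofReal (4 * ε) * (1 / 2) := by
        rw [ENNReal.ofReal_mul (by positivity), ENNReal.ofReal_div_of_pos (by norm_num)]
        simp
    _ ≤ _ := mul_le_mul_right hhalf _
    _ ≤ _ := mul_meas_ge_le_lintegral (measurable_bestGradSq v g A f _) _

end LowerBound

theorem revealsNext_noisy {f' : Pt d → Pt d} (hf' : IsZeroChain f') (p : ℝ) :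
    RevealsNext fun (_ : Fin n) x ξ (_ : ℝ≥0) => noisy f' p x ξ where
  suppLT _ _ _ hx ξ _ := hf'.suppLT_noisy p ξ hx
  suppLT_false _ _ _ hx _ := suppLT_noisy_false f' p hx

/-! ### The choice of parameters -/

theorem exists_chain_length {R : ℝ} (hR : 12288 < R) :
    ∃ T : ℕ, 3072 * (T + 2) ≤ R ∧ 2 * ⌊1 / 12288 * R⌋₊ ≤ T + 1 := by
  obtain ⟨T, hT⟩ : ∃ T, ⌊R / 3072⌋₊ = T + 2 :=
    Nat.exists_eq_add_of_le' (Nat.le_floor (by norm_num; linarith))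
  have hle : (T : ℝ) + 2 ≤ R / 3072 := by
    exact_mod_cast hT ▸ Nat.floor_le (show 0 ≤ R / 3072 by linarith)
  have hlt : R / 3072 < (T : ℝ) + 2 + 1 := by
    exact_mod_cast hT ▸ Nat.lt_floor_add_one (R / 3072)
  have hfloor := Nat.floor_le (show 0 ≤ 1 / 12288 * R by linarith)
  refine ⟨T, by linarith, ?_⟩
  have : (2 : ℝ) * ⌊1 / 12288 * R⌋₊ ≤ T + 1 := by linarith
  exact_mod_cast this

theorem exists_success_probability {ε : ℝ} (hε : 0 < ε) (σ : ℝ) :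
    ∃ p : unitInterval, (p : ℝ) ≠ 0 ∧ (1 - p) / p * (64 * ε) ≤ σ ^ 2 ∧
      p * (1 / 256 * max (⌈σ ^ 2 / ε⌉₊ : ℝ) 1) ≤ 1 / 4 := by
  obtain ⟨r, hr⟩ : ∃ r, r = σ ^ 2 / ε := ⟨_, rfl⟩
  have hr0 : 0 ≤ r := by rw [hr]; positivity
  refine ⟨⟨64 / (64 + r), by positivity, div_le_one_of_le₀ (by linarith) (by positivity)⟩,
    (by positivity : 64 / (64 + r) ≠ 0), le_of_eq ?_, ?_⟩
  · have hσ : σ ^ 2 = r * ε := by rw [hr, div_mul_cancel₀ _ hε.ne']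
    rw [hσ]
    field
  · have hmax : max (⌈r⌉₊ : ℝ) 1 ≤ r + 1 := max_le (Nat.ceil_lt_add_one hr0).le (by linarith)
    rw [← hr, div_mul_eq_mul_div, div_le_iff₀ (by positivity)]
    linarith

end TimeOracle

end

theorem theorem1_general {L Δ ε : ℝ} (hL : 0 < L) (hε : 0 < ε) (hεLΔ : 12288 * ε < L * Δ) {d : ℕ}
    (hd : L * Δ / ε / 3072 ≤ d) :
    ∃ f : TimeOracle.Pt d → ℝ,
      TimeOracle.IsSmooth L f ∧
      (∃ fstar : ℝ, (∀ x, fstar ≤ f x) ∧ f 0 - fstar ≤ Δ) ∧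
      ∀ σ : ℝ, ∃ (D : Measure Bool) (_ : IsProbabilityMeasure D)
        (G : TimeOracle.Pt d → Bool → TimeOracle.Pt d),
        TimeOracle.IsStochasticGradient D f σ G ∧
        ∀ (n : ℕ) (v : Fin n → ℝ → ℝ), (∀ i τ, 0 ≤ τ → 0 ≤ v i τ) →
        ∀ A : TimeOracle.Algorithm n d, A.IsZeroRespecting →
          Measurable (TimeOracle.bestGradSq v (fun _ x ξ _ => G x ξ) A f
            (TimeOracle.lowerTime v (1 / 256 * max (⌈σ ^ 2 / ε⌉₊ : ℝ) 1)
              ⌊1 / 12288 * (L * Δ / ε)⌋₊ / 2)) ∧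
          ENNReal.ofReal ε <
            ∫⁻ ω, TimeOracle.bestGradSq v (fun _ x ξ _ => G x ξ) A f
              (TimeOracle.lowerTime v (1 / 256 * max (⌈σ ^ 2 / ε⌉₊ : ℝ) 1)
                ⌊1 / 12288 * (L * Δ / ε)⌋₊ / 2) ω
              ∂(Measure.infinitePi fun _ : ℕ => D) := by
  obtain ⟨T, hT, hK⟩ := TimeOracle.exists_chain_length ((lt_div_iff₀ hε).2 hεLΔ)
  have hTd : T + 1 ≤ d := by
    have : (T : ℝ) + 1 ≤ d := by linarith
    exact_mod_cast this
  have hTΔ : 3072 * ε * ((T + 1 : ℕ) + 1) ≤ L * Δ := by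
    rw [le_div_iff₀ hε] at hT
    push_cast
    linarith
  have hgrad := TimeOracle.gradient_hardFun hL hε hTd
  have hchain := TimeOracle.isZeroChain_hardGrad (d := d) L ε (T + 1)
  refine ⟨TimeOracle.hardFun L ε (T + 1), TimeOracle.isSmooth_hardFun hL hε hTd,
    TimeOracle.exists_le_hardFun_and_hardFun_zero_sub_le hL hε hTΔ, fun σ => ?_⟩
  obtain ⟨p, hp, hσ, hpM⟩ := TimeOracle.exists_success_probability hε σ
  refine ⟨ProbabilityTheory.bernoulliMeasure true false p, inferInstance,
    TimeOracle.noisy (TimeOracle.hardGrad L ε (T + 1)) p, ?_, fun n v _ A hA =>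
    ⟨TimeOracle.measurable_bestGradSq v _ A _ _, ?_⟩⟩
  · rw [← hgrad] at hchain ⊢
    refine TimeOracle.isStochasticGradient_noisy hchain (by positivity) (fun x i hx => ?_) hp hσ
    rw [hgrad]
    exact TimeOracle.hardGrad_apply_sq_le hε.le hx
  · refine TimeOracle.lt_lintegral_bestGradSq hA (TimeOracle.revealsNext_noisy hchain p) hε
      (by positivity) ?_ hK fun x hx => ?_
    · rwa [ProbabilityTheory.bernoulliMeasure_real_apply_of_mem_of_notMem p (by simp) (by simp)
        (by simp)]
    · rw [hgrad]
      exact TimeOracle.four_mul_le_norm_hardGrad_sq hε hTd hx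

/-- The stochastic gradient mapping `G` is the same for all workers and times, i.e.
`g_i(x; ξ, t) = G(x, ξ)`; the samples of different iterations are independent with law `D`. -/
theorem theorem1 :
    ∃ c' c₁ c₂ : ℝ, 0 < c' ∧ 0 < c₁ ∧ 0 < c₂ ∧
      ∀ L Δ ε : ℝ, 0 < L → 0 < Δ → 0 < ε → ε < c' * L * Δ →
      ∃ d₀ : ℕ, ∀ d : ℕ, d₀ ≤ d →
      ∀ (n : ℕ) (v : Fin n → ℝ → ℝ), (∀ i, TimeOracle.IsComputationPower (v i)) →
      ∀ (σ : ℝ) (A : TimeOracle.Algorithm n d), A.IsZeroRespecting →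
      ∃ f : TimeOracle.Pt d → ℝ,
        TimeOracle.IsSmooth L f ∧
        (∃ fstar : ℝ, (∀ x, fstar ≤ f x) ∧ f 0 - fstar ≤ Δ) ∧
        ∃ (Ξ : Type) (_ : MeasurableSpace Ξ) (D : Measure Ξ) (_ : IsProbabilityMeasure D)
          (G : TimeOracle.Pt d → Ξ → TimeOracle.Pt d),
          TimeOracle.IsStochasticGradient D f σ G ∧
          Measurable (TimeOracle.bestGradSq v (fun _ x ξ _ => G x ξ) A f
            (TimeOracle.lowerTime v (c₂ * max (⌈σ ^ 2 / ε⌉₊ : ℝ) 1) ⌊c₁ * (L * Δ / ε)⌋₊ / 2)) ∧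
          ENNReal.ofReal ε <
            ∫⁻ ω, TimeOracle.bestGradSq v (fun _ x ξ _ => G x ξ) A f
              (TimeOracle.lowerTime v (c₂ * max (⌈σ ^ 2 / ε⌉₊ : ℝ) 1) ⌊c₁ * (L * Δ / ε)⌋₊ / 2) ω
              ∂(Measure.infinitePi fun _ : ℕ => D) := by
  refine ⟨1 / 12288, 1 / 12288, 1 / 256, by norm_num, by norm_num, by norm_num,
    fun L Δ ε hL _ hε hεLΔ => ⟨⌈L * Δ / ε / 3072⌉₊, fun d hd n v hv σ A hA => ?_⟩⟩
  obtain ⟨f, hf, hmin, hG⟩ := theorem1_general hL hε (by linarith) (Nat.ceil_le.1 hd)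
  obtain ⟨D, hD, G, hDG, hlower⟩ := hG σ
  exact ⟨f, hf, hmin, Bool, inferInstance, D, hD, G, hDG, hlower n v (fun i => (hv i).nonneg) A hA⟩
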